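/- Throughout, algebras are complex and associative, not necessarily unital; ideals and one-sided ideals are linear subspaces, not necessarily closed, and "ideal" without further qualification means two-sided ideal. For an algebra $A$ put $A^1=A$ if $A$ is unital, and let $A^1$ be the algebra obtained by adjoining an identity otherwise. The spectrum $\sigma(a)=\sigma_A(a)$ of $a\in A$ is the set of all $\lambda\in\mathbb{C}$ such that $a-\lambda$ is not invertible in $A^1$; "countable" means finite or countable. For an ideal $I$ of $A$ and $a\in A$, $a/I$ denotes the image of $a$ in $A/I$. An algebra is scattered if all its elements have countable spectrum; a (one-sided or two-sided) ideal is scattered if it is a scattered algebra. An ideal $I$ of $A$ is thin if for each $a\in A$ there is a countable set $Z\subset\mathbb{C}$ with $\sigma_A(a)\subset \mathrm{pc}(\sigma_{A/I}(a/I))\cup Z$, where $\mathrm{pc}(K)=\{z\in\mathbb{C}: |p(z)|\le \sup_{w\in K}|p(w)| \text{ for every polynomial } p\}$ is the polynomially convex hull. Let $\mathcal{S}(A)=\{a\in A:\sigma(a)\text{ is countable}\}$. Let $\mathrm{rad}(A)$ be the Jacobson radical of $A$, let $\mathrm{soc}(A)$ be the socle (the sum of all minimal left ideals), and let $\mathrm{psoc}(A)=\{x\in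 A: x/\mathrm{rad}(A)\in \mathrm{soc}(A/\mathrm{rad}(A))\}$. Define by transfinite recursion $I_0=0$, $I_{\alpha+1}=\{x\in A: x/I_\alpha\in\mathrm{psoc}(A/I_\alpha)\}$, and $I_\alpha=\bigcup_{\beta<\alpha}I_\beta$ for limit ordinals $\alpha$. This increasing chain of ideals stabilizes, and the scattered radical $\mathcal{R}_s(A)$ is the ideal $I_\delta$ at which it does: $I_\delta=I_{\delta+1}$. **Theorem.** Let $A$ be a Banach algebra. Then 1. $\mathcal{R}_s(A)$ contains all one-sided, not necessarily closed, scattered ideals of $A$; 2. $\mathcal{R}_s(A)$ is the largest thin ideal and the largest scattered ideal of $A$; 3. $\mathcal{R}_s(A)=\{a\in A:\sigma(ax)\text{ is countable for each }x\in A\}$; 4. $\mathcal{R}_s(A)$ is the largest ideal of $A$ contained in $\mathcal{S}(A)$; 5. $\mathcal{R}_s(A)+\mathcal{S}(A)\subset\mathcal{S}(A)$. -/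

import Mathlib

open scoped Pointwise

universe u

noncomputable section

/-! Complex associative algebras `A`, not assumed to have an identity element. -/

namespace ScatAlg

section Spectrum

variable {A : Type u} [NonUnitalRing A] [Module ℂ A] [IsScalarTower ℂ A A] [SMulCommClass ℂ A A]

/-- `e` is a (two-sided) identity element of `A`. -/
def IsIdentity (e : A) : Prop := ∀ x : A, e * x = x ∧ x * e = x

/-- The spectrum `σ_A(a)`: the set of `z` such that `z - a` is not invertible in `A¹`, where
`A¹ = A` if `A` has an identity element, and `A¹` is the unitization of `A` otherwise. -/
def algSpectrum (a : A) : Set ℂ :=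
  {z | (∃ e : A, IsIdentity e ∧ ¬ ∃ b : A, (z • e - a) * b = e ∧ b * (z • e - a) = e) ∨
    ((¬ ∃ e : A, IsIdentity e) ∧ z ∈ spectrum ℂ (a : Unitization ℂ A))}

variable (A) in
/-- The set `S(A)` of all elements with (finite or) countable spectrum. -/
def countableSpectrumSet : Set A := {a | (algSpectrum a).Countable}

variable (A) in
/-- An algebra is scattered if the spectrum of each of its elements is at most countable. -/
def IsScattered : Prop := ∀ a : A, (algSpectrum a).Countable

end Spectrum

/-- The polynomially convex hull of a subset of `ℂ` (the supremum is taken in `[0, ∞]`). -/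
def polyHull (K : Set ℂ) : Set ℂ :=
  {z | ∀ p : Polynomial ℂ, ‖p.eval z‖ₑ ≤ ⨆ w ∈ K, ‖p.eval w‖ₑ}

section Ideals

variable {A : Type u} [NonUnitalRing A] [Module ℂ A]

/-- A linear subspace that is a left ideal. -/
def IsLeftIdeal (J : Submodule ℂ A) : Prop := ∀ a x : A, x ∈ J → a * x ∈ J

/-- A linear subspace that is a right ideal. -/
def IsRightIdeal (J : Submodule ℂ A) : Prop := ∀ a x : A, x ∈ J → x * a ∈ J

/-- A one-sided ideal as an algebra in its own right. -/
def oneSidedSubalgebra (J : Submodule ℂ A) (h : IsLeftIdeal J ∨ IsRightIdeal J) :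
    NonUnitalSubalgebra ℂ A :=
  { J with
    mul_mem' := fun {x y} hx hy => h.elim (fun h => h x y hy) (fun h => h y x hx) }

variable (A) in
/-- A two-sided (not necessarily closed) ideal of the algebra `A`. -/
structure AlgIdeal extends Submodule ℂ A where
  mul_left_mem : IsLeftIdeal toSubmodule
  mul_right_mem : IsRightIdeal toSubmodule

namespace AlgIdeal

theorem toSubmodule_injective :
    Function.Injective (toSubmodule : AlgIdeal A → Submodule ℂ A) := by
  rintro ⟨I, _, _⟩ ⟨J, _, _⟩ h
  cases h
  rfl

instance : SetLike (AlgIdeal A) A where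
  coe I := I.toSubmodule
  coe_injective := fun _ _ h => toSubmodule_injective (SetLike.coe_injective h)

instance : PartialOrder (AlgIdeal A) := PartialOrder.ofSetLike (AlgIdeal A) A

theorem mem_toSubmodule {I : AlgIdeal A} {x : A} : x ∈ I.toSubmodule ↔ x ∈ I := Iff.rfl

/-- The zero ideal. -/
def zero : AlgIdeal A where
  toSubmodule := ⊥
  mul_left_mem := by
    intro a x hx
    rw [Submodule.mem_bot] at hx ⊢
    simp [hx]
  mul_right_mem := by
    intro a x hx
    rw [Submodule.mem_bot] at hx ⊢
    simp [hx]

/-- The quotient algebra `A/I`. -/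
def Quot (I : AlgIdeal A) : Type u := A ⧸ I.toSubmodule

variable (I : AlgIdeal A)

instance : AddCommGroup I.Quot := inferInstanceAs (AddCommGroup (A ⧸ I.toSubmodule))

instance : Module ℂ I.Quot := inferInstanceAs (Module ℂ (A ⧸ I.toSubmodule))

/-- The quotient map `a ↦ a/I`, as a linear map. -/
def quotMap : A →ₗ[ℂ] I.Quot := I.toSubmodule.mkQ

theorem quotMap_surjective : Function.Surjective I.quotMap := I.toSubmodule.mkQ_surjective

theorem quotMap_eq_iff {x y : A} : I.quotMap x = I.quotMap y ↔ x - y ∈ I :=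
  Submodule.Quotient.eq I.toSubmodule

instance : Mul I.Quot where
  mul := Quotient.map₂ (· * ·) (by
    intro a a' ha b b' hb
    have ha' : a - a' ∈ I.toSubmodule := (Submodule.quotientRel_def _).1 ha
    have hb' : b - b' ∈ I.toSubmodule := (Submodule.quotientRel_def _).1 hb
    refine (Submodule.quotientRel_def _).2 ?_
    have h := I.toSubmodule.add_mem (I.mul_right_mem b _ ha') (I.mul_left_mem a' _ hb')
    have e : (a - a') * b + a' * (b - b') = a * b - a' * b' := by
      rw [sub_mul, mul_sub]; abel
    rwa [e] at h)

theorem quotMap_mul (x y : A) : I.quotMap (x * y) = I.quotMap x * I.quotMap y := rfl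

end AlgIdeal

end Ideals

section Quotient

variable {A : Type u} [NonUnitalRing A] [Module ℂ A] [IsScalarTower ℂ A A] [SMulCommClass ℂ A A]

namespace AlgIdeal

/-- The sum of a family of ideals (the union of the family, when it is a chain). -/
def sum {ι : Sort*} (I : ι → AlgIdeal A) : AlgIdeal A where
  toSubmodule := ⨆ i, (I i).toSubmodule
  mul_left_mem := by
    intro a x hx
    have h : (⨆ i, (I i).toSubmodule) ≤
        (⨆ i, (I i).toSubmodule).comap (LinearMap.mulLeft ℂ a) :=
      iSup_le fun i y hy => Submodule.mem_iSup_of_mem i ((I i).mul_left_mem a y hy)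
    exact h hx
  mul_right_mem := by
    intro a x hx
    have h : (⨆ i, (I i).toSubmodule) ≤
        (⨆ i, (I i).toSubmodule).comap (LinearMap.mulRight ℂ a) :=
      iSup_le fun i y hy => Submodule.mem_iSup_of_mem i ((I i).mul_right_mem a y hy)
    exact h hx

variable (I : AlgIdeal A)

instance : NonUnitalRing I.Quot :=
  { (inferInstance : AddCommGroup I.Quot), (inferInstance : Mul I.Quot) with
    left_distrib := by
      intro a b c
      obtain ⟨a, rfl⟩ := I.quotMap_surjective a
      obtain ⟨b, rfl⟩ := I.quotMap_surjective b
      obtain ⟨c, rfl⟩ := I.quotMap_surjective c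
      change I.quotMap (a * (b + c)) = I.quotMap (a * b + a * c)
      rw [mul_add]
    right_distrib := by
      intro a b c
      obtain ⟨a, rfl⟩ := I.quotMap_surjective a
      obtain ⟨b, rfl⟩ := I.quotMap_surjective b
      obtain ⟨c, rfl⟩ := I.quotMap_surjective c
      change I.quotMap ((a + b) * c) = I.quotMap (a * c + b * c)
      rw [add_mul]
    zero_mul := by
      intro a
      obtain ⟨a, rfl⟩ := I.quotMap_surjective a
      change I.quotMap (0 * a) = I.quotMap 0
      rw [zero_mul]
    mul_zero := by
      intro a
      obtain ⟨a, rfl⟩ := I.quotMap_surjective a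
      change I.quotMap (a * 0) = I.quotMap 0
      rw [mul_zero]
    mul_assoc := by
      intro a b c
      obtain ⟨a, rfl⟩ := I.quotMap_surjective a
      obtain ⟨b, rfl⟩ := I.quotMap_surjective b
      obtain ⟨c, rfl⟩ := I.quotMap_surjective c
      change I.quotMap (a * b * c) = I.quotMap (a * (b * c))
      rw [mul_assoc] }

instance : IsScalarTower ℂ I.Quot I.Quot where
  smul_assoc := by
    intro z a b
    obtain ⟨a, rfl⟩ := I.quotMap_surjective a
    obtain ⟨b, rfl⟩ := I.quotMap_surjective b
    change I.quotMap ((z • a) * b) = I.quotMap (z • (a * b))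
    rw [smul_mul_assoc]

instance : SMulCommClass ℂ I.Quot I.Quot where
  smul_comm := by
    intro z a b
    obtain ⟨a, rfl⟩ := I.quotMap_surjective a
    obtain ⟨b, rfl⟩ := I.quotMap_surjective b
    change I.quotMap (z • (a * b)) = I.quotMap (a * (z • b))
    rw [mul_smul_comm]

/-- The preimage in `A` of an ideal of `A/I`. -/
def preimage (K : AlgIdeal I.Quot) : AlgIdeal A where
  toSubmodule := K.toSubmodule.comap I.quotMap
  mul_left_mem := fun a x hx => K.mul_left_mem (I.quotMap a) (I.quotMap x) hx
  mul_right_mem := fun a x hx => K.mul_right_mem (I.quotMap a) (I.quotMap x) hx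

theorem le_preimage (K : AlgIdeal I.Quot) : I ≤ I.preimage K := by
  intro x hx
  change I.quotMap x ∈ K.toSubmodule
  have h : I.quotMap x = 0 := (Submodule.Quotient.mk_eq_zero I.toSubmodule).2 hx
  rw [h]
  exact K.toSubmodule.zero_mem

end AlgIdeal

/-- An ideal `I` is thin if for each `a` there is a countable set `Z` such that
`σ(a) ⊆ pc(σ(a/I)) ∪ Z`. -/
def IsThin (I : AlgIdeal A) : Prop :=
  ∀ a : A, ∃ Z : Set ℂ, Z.Countable ∧
    algSpectrum a ⊆ polyHull (algSpectrum (I.quotMap a)) ∪ Z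

/-- A scattered (one-sided, not necessarily closed) ideal: a left or right ideal which is
a scattered algebra. -/
def IsScatteredIdeal (J : Submodule ℂ A) : Prop :=
  ∃ h : IsLeftIdeal J ∨ IsRightIdeal J, IsScattered (oneSidedSubalgebra J h)

end Quotient

section Radical

variable (A : Type u) [NonUnitalRing A] [Module ℂ A] [IsScalarTower ℂ A A] [SMulCommClass ℂ A A]

/-- The Jacobson radical `rad(A)`, that is, the part in `A` of the Jacobson radical of the
unital ring obtained from `A` by adjoining an identity element. (If `A` already has an identity
element, that ring is isomorphic to `A × ℂ`, and this is still the Jacobson radical of `A`.) -/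
def jacobsonRadical : AlgIdeal A where
  carrier := {a | (a : Unitization ℂ A) ∈ Ring.jacobson (Unitization ℂ A)}
  add_mem' := by
    intro a b ha hb
    simp only [Set.mem_ofPred_eq, Unitization.inr_add] at *
    exact add_mem ha hb
  zero_mem' := by simp
  smul_mem' := by
    intro z a ha
    simp only [Set.mem_ofPred_eq, Unitization.inr_smul] at *
    rw [Algebra.smul_def]
    exact Ideal.mul_mem_left _ _ ha
  mul_left_mem := by
    intro a x hx
    change ((a * x : A) : Unitization ℂ A) ∈ Ring.jacobson (Unitization ℂ A)
    rw [Unitization.inr_mul]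
    exact Ideal.mul_mem_left _ _ hx
  mul_right_mem := by
    intro a x hx
    change ((x * a : A) : Unitization ℂ A) ∈ Ring.jacobson (Unitization ℂ A)
    rw [Unitization.inr_mul]
    exact Ideal.mul_mem_right _ _ hx

variable {A} in
/-- A minimal left ideal: minimal among the nonzero left ideals. -/
def IsMinimalLeftIdeal (L : Submodule ℂ A) : Prop :=
  Minimal (fun K : Submodule ℂ A => IsLeftIdeal K ∧ K ≠ ⊥) L

/-- The (left) socle: the sum of all minimal left ideals. -/
def socle : AlgIdeal A where
  toSubmodule := sSup {L | IsMinimalLeftIdeal L}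
  mul_left_mem := by
    intro a x hx
    have h : sSup {L : Submodule ℂ A | IsMinimalLeftIdeal L} ≤
        (sSup {L | IsMinimalLeftIdeal L}).comap (LinearMap.mulLeft ℂ a) :=
      sSup_le fun L (hL : IsMinimalLeftIdeal L) y hy =>
        (le_sSup hL : L ≤ sSup {L | IsMinimalLeftIdeal L}) (hL.1.1 a y hy)
    exact h hx
  mul_right_mem := by
    intro a x hx
    have h : sSup {L : Submodule ℂ A | IsMinimalLeftIdeal L} ≤
        (sSup {L | IsMinimalLeftIdeal L}).comap (LinearMap.mulRight ℂ a) := by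
      refine sSup_le fun L (hL : IsMinimalLeftIdeal L) y hy => ?_
      change y * a ∈ sSup {L : Submodule ℂ A | IsMinimalLeftIdeal L}
      by_cases h0 : L.map (LinearMap.mulRight ℂ a) = ⊥
      · have : y * a ∈ L.map (LinearMap.mulRight ℂ a) := ⟨y, hy, rfl⟩
        rw [h0, Submodule.mem_bot] at this
        rw [this]
        exact Submodule.zero_mem _
      refine (le_sSup (a := L.map (LinearMap.mulRight ℂ a)) ?_ :
        L.map (LinearMap.mulRight ℂ a) ≤ _) ⟨y, hy, rfl⟩
      refine ⟨⟨?_, h0⟩, ?_⟩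
      · rintro b _ ⟨w, hw, rfl⟩
        exact ⟨b * w, hL.1.1 b w hw, mul_assoc b w a⟩
      · rintro K ⟨hK, hK0⟩ hKL
        have hle : L ≤ L ⊓ K.comap (LinearMap.mulRight ℂ a) := by
          refine hL.le_of_le ⟨?_, ?_⟩ inf_le_left
          · rintro b w ⟨hw, hw'⟩
            refine ⟨hL.1.1 b w hw, ?_⟩
            change b * w * a ∈ K
            rw [mul_assoc]
            exact hK b _ hw'
          · intro hbot
            refine hK0 ((Submodule.eq_bot_iff K).2 fun k hk => ?_)
            obtain ⟨w, hw, rfl⟩ := hKL hk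
            have : w ∈ L ⊓ K.comap (LinearMap.mulRight ℂ a) := ⟨hw, hk⟩
            rw [hbot, Submodule.mem_bot] at this
            simp [this]
        rintro _ ⟨w, hw, rfl⟩
        exact (hle hw).2
    exact h hx

/-- The presocle, i.e. the socle modulo the Jacobson radical:
`psoc(A) = {x | x/rad(A) ∈ soc(A/rad(A))}`. -/
def presocle : AlgIdeal A := (jacobsonRadical A).preimage (socle (jacobsonRadical A).Quot)

/-- The algebraic convolution chain of `psoc`: `I₀ = 0`, `I_{α+1}` is the preimage in `A` of
`psoc(A/I_α)`, and `I_α` is the union of the preceding ideals for limit `α`. -/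
def convolutionChain (α : Ordinal.{u}) : AlgIdeal A :=
  Ordinal.limitRecOn α AlgIdeal.zero (fun _ I => I.preimage (presocle I.Quot))
    (fun β _ ih => AlgIdeal.sum fun γ : Set.Iio β => ih γ.1 γ.2)

theorem convolutionChain_zero : convolutionChain A 0 = AlgIdeal.zero :=
  Ordinal.limitRecOn_zero _ _ _

theorem convolutionChain_succ (α : Ordinal.{u}) :
    convolutionChain A (α + 1) =
      (convolutionChain A α).preimage (presocle (convolutionChain A α).Quot) :=
  Ordinal.limitRecOn_add_one _ _ _ _

theorem convolutionChain_limit {α : Ordinal.{u}} (h : Order.IsSuccLimit α) :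
    convolutionChain A α = AlgIdeal.sum fun γ : Set.Iio α => convolutionChain A γ.1 :=
  Ordinal.limitRecOn_limit _ _ _ _ h

/-- The scattered radical `psoc*(A)`: the ideal at which the convolution chain of `psoc`
stabilizes. -/
def scatteredRadical : AlgIdeal A :=
  convolutionChain A (sInf {δ | convolutionChain A (δ + 1) = convolutionChain A δ})

theorem convolutionChain_mono : Monotone (convolutionChain A) := by
  intro α β
  induction β using Ordinal.limitRecOn with
  | zero =>
    intro h
    rw [nonpos_iff_eq_zero.1 h]
  | add_one β ih =>
    intro h
    rcases h.lt_or_eq with h | rfl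
    · rw [convolutionChain_succ]
      exact (ih (Order.lt_add_one_iff.1 h)).trans (AlgIdeal.le_preimage _ _)
    · exact le_rfl
  | limit β hβ ih =>
    intro h
    rcases h.lt_or_eq with h | rfl
    · rw [convolutionChain_limit A hβ]
      intro x hx
      exact Submodule.mem_iSup_of_mem
        (p := fun γ : Set.Iio β => (convolutionChain A γ.1).toSubmodule) ⟨α, h⟩ hx
    · exact le_rfl

/-- The convolution chain does stabilize. -/
theorem exists_stable : ∃ δ, convolutionChain A (δ + 1) = convolutionChain A δ := by
  by_contra! hne
  have hmono : StrictMono (convolutionChain A) := by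
    intro α β h
    refine lt_of_lt_of_le ?_ (convolutionChain_mono A (Order.add_one_le_of_lt h))
    exact lt_of_le_of_ne (convolutionChain_mono A (le_self_add)) (hne α).symm
  exact not_injective_of_ordinal _ hmono.injective

end Radical

end ScatAlg

end

/-!
Spectra are handled through the quasispectrum `quasispectrum ℂ a`, which differs from `σ(a)` at
most by the point `0` and is described by quasi-inverses, also modulo an ideal that is not closed
(`AlgIdeal.notMem_quasispectrum_quotMap_iff`). Write `K_α(a)` for the quasispectrum of the image of
`a` in `A/I_α`, where `I_α` is the convolution chain. These sets are compact and decrease with `α`;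
at limit ordinals they are intersections, since quasi-invertibility modulo a union of ideals is
quasi-invertibility modulo one of them. There are two main points.

*The radical is small.* Let `U_α` be the unbounded component of the complement of `K_α(a)`. Then
`σ(a) ∩ U_α` is countable for all `α`
(`countable_quasispectrum_inter_outerComponent_convolutionChain`), by transfinite induction. For
the successor step the algebra `(A/I_α)/rad` is semisimple, hence a Banach algebra for the
quotient norm although `I_α` need not be closed (`exists_normedRing_of_jacobson_eq_bot`), and its
socle satisfies a Fredholm alternative (`countable_spectrum_inter_outerComponent`): by Schur's lemma
and the Gelfand–Mazur theorem `sΩs ⊆ ℂs` for `s` in a minimal left ideal, which reduces the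
invertibility of an analytic family `1 - g(z)s` to a scalar equation, and a sum of such elements is
treated one summand at a time, using that connected open sets of the plane remain connected when
countably many points are removed. That connectedness also compares the components `U_α` and
`U_{α+1}` (`outerComponent_diff_subset`). At a limit ordinal `U_α` is a union of earlier components,
because paths are compact, and countably many of them suffice. Thinness of the radical follows as
the complement of `U_α` lies in the polynomially convex hull of `K_α(a)`, by the maximum principle.
If the image of `a` modulo the radical has countable spectrum, then `U_α` is the whole complement of
`K_α(a)` and `σ(a)` is countable (`countable_quasispectrum_of_countable_quot`).

*The radical is large.* If all products `ax` have countable spectrum, then `a` lies in the radical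
`R` (`mem_scatteredRadical_of_forall_mul`). By stability of the chain, `A/R` is semisimple with zero
socle, so it is enough that in a semisimple Banach algebra with zero socle no `b ≠ 0` has only
multiples with countable spectrum (`eq_zero_of_countable_of_socle_eq_zero`). Countable spectra
provide Riesz idempotents in the right ideal of `b` (`exists_isIdempotentElem_of_countable`). If one
of them could not be split, its corner would consist of scalars and it would generate a minimal left
ideal. So they all split, which gives a binary tree of idempotents, and a fast converging
combination of its levels has a different spectral value along each branch
(`IdempotentSplitting.exists_not_countable_spectrum`).
-/

namespace ScatAlg

open Set Filter Topology Metric Bornology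

/-! ### Countable sets and unbounded components in the plane -/

/-- A locally countable set in the plane is countable, by the Lindelöf property. -/
theorem countable_of_forall_nhdsWithin {S : Set ℂ}
    (h : ∀ z ∈ S, ∃ U ∈ 𝓝 z, (S ∩ U).Countable) : S.Countable := by
  choose! U hU hc using h
  obtain ⟨t, htS, htc, hcov⟩ := TopologicalSpace.countable_cover_nhdsWithin
    (f := U) (s := S) fun x hx => mem_nhdsWithin_of_mem_nhds (hU x hx)
  refine (htc.biUnion fun x hx => hc x (htS hx)).mono fun z hz => ?_
  obtain ⟨x, hx, hzx⟩ := mem_iUnion₂.1 (hcov hz)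
  exact mem_iUnion₂.2 ⟨x, hx, hz, hzx⟩

/-- An open ball is homeomorphic to the plane, in which complements of countable sets are
path-connected. -/
theorem isPathConnected_ball_diff_countable {N : Set ℂ} (hN : N.Countable) (c : ℂ) {r : ℝ}
    (hr : 0 < r) : IsPathConnected (ball c r \ N) := by
  let φ := OpenPartialHomeomorph.univBall c r
  have hs : φ.source = univ := OpenPartialHomeomorph.univBall_source c r
  have ht : φ.target = ball c r := OpenPartialHomeomorph.univBall_target c hr
  have hinj : Function.Injective φ := by
    have := φ.injOn
    rwa [hs, injOn_univ] at this
  have hpc : IsPathConnected (φ ⁻¹' N)ᶜ :=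
    (hN.preimage_of_injOn hinj.injOn).isPathConnected_compl_of_one_lt_rank
      (by rw [Complex.rank_real_complex]; exact Nat.one_lt_ofNat)
  have himg := hpc.image' (f := φ)
    (φ.continuousOn.mono (by rw [hs]; exact subset_univ _))
  convert himg using 1
  ext z
  constructor
  · rintro ⟨hz, hzN⟩
    rw [← ht] at hz
    refine ⟨φ.symm z, ?_, φ.right_inv hz⟩
    simpa [φ.right_inv hz] using hzN
  · rintro ⟨w, hw, rfl⟩
    refine ⟨?_, hw⟩
    rw [← ht]
    exact φ.map_source (by rw [hs]; trivial)

theorem joinedIn_diff_countable {D N : Set ℂ} (hD : IsOpen D) (hc : IsPreconnected D)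
    (hN : N.Countable) {x y : ℂ} (hx : x ∈ D \ N) (hy : y ∈ D \ N) : JoinedIn (D \ N) x y := by
  -- being joined off `N` holds locally, and is transitive through points outside `N`
  have key := hc.induction₂
    (fun x y => ∀ᶠ p in 𝓝 x ×ˢ 𝓝 y, p.1 ∉ N → p.2 ∉ N → JoinedIn (D \ N) p.1 p.2)
    ?_ ?_ ?_ hx.1 hy.1
  · exact (nhds_prod_eq (x := x) (y := y) ▸ key).self_of_nhds hx.2 hy.2
  · intro z hz
    obtain ⟨r, hr, hball⟩ := Metric.isOpen_iff.1 hD z hz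
    filter_upwards [mem_nhdsWithin_of_mem_nhds (ball_mem_nhds z hr)] with w hw
    filter_upwards [prod_mem_prod (ball_mem_nhds z hr) (isOpen_ball.mem_nhds hw)] with p hp h1 h2
    exact ((isPathConnected_ball_diff_countable hN z hr).joinedIn _ ⟨hp.1, h1⟩ _ ⟨hp.2, h2⟩).mono
      (sdiff_subset_sdiff_left hball)
  · intro a b c _ _ _ hab hbc
    obtain ⟨u, hu, v, hv, huv⟩ := eventually_prod_iff.1 hab
    obtain ⟨v', hv', w, hw, hvw⟩ := eventually_prod_iff.1 hbc
    have hdense : Dense Nᶜ := hN.dense_compl ℝ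
    obtain ⟨m, hm, hmN⟩ := mem_closure_iff_nhds.1 (hdense b) _ (hv.and hv')
    filter_upwards [hu.prod_mk hw] with p hp h1 h2
    exact (huv hp.1 hm.1 h1 hmN).trans (hvw hm.2 hp.2 hmN h2)
  · intro a b _ _ hab
    have := (Filter.prod_comm (f := 𝓝 a) (g := 𝓝 b)) ▸ hab
    rw [eventually_map] at this
    filter_upwards [this] with p hp h1 h2
    exact (hp h2 h1).symm

theorem isPreconnected_diff_countable {D N : Set ℂ} (hD : IsOpen D) (hc : IsPreconnected D)
    (hN : N.Countable) : IsPreconnected (D \ N) := by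
  rcases (D \ N).eq_empty_or_nonempty with h | ⟨x, hx⟩
  · rw [h]
    exact isPreconnected_empty
  · exact IsPathConnected.isConnected
      ⟨x, hx, fun _ hy => joinedIn_diff_countable hD hc hN hx hy⟩ |>.isPreconnected

/-- The exterior of a disc is the image of a half plane under `exp`. -/
theorem isPathConnected_norm_gt {r : ℝ} (hr : 0 < r) : IsPathConnected {w : ℂ | r < ‖w‖} := by
  have h1 : IsPathConnected {z : ℂ | Real.log r < z.re} :=
    (convex_halfSpace_re_gt _).isPathConnected ⟨((Real.log r + 1 : ℝ) : ℂ), by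
      simp⟩
  have h2 := h1.image Complex.continuous_exp
  convert h2 using 1
  ext w
  constructor
  · intro hw
    have hw : r < ‖w‖ := hw
    have hw0 : w ≠ 0 := norm_pos_iff.1 (hr.trans hw)
    refine ⟨Complex.log w, ?_, Complex.exp_log hw0⟩
    change Real.log r < (Complex.log w).re
    rw [Complex.log_re]
    exact Real.log_lt_log hr hw
  · rintro ⟨z, hz, rfl⟩
    change r < ‖Complex.exp z‖
    rw [Complex.norm_exp]
    exact (Real.log_lt_iff_lt_exp hr).1 hz

/-- For a bounded set `K`, the unbounded component of the complement of `K`: the points that can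
be joined in `Kᶜ` to all points of large modulus. -/
def outerComponent (K : Set ℂ) : Set ℂ := {z | ∀ᶠ w in cobounded ℂ, JoinedIn Kᶜ z w}

theorem eventually_cobounded_iff {P : ℂ → Prop} :
    (∀ᶠ w in cobounded ℂ, P w) ↔ ∃ r : ℝ, 0 < r ∧ ∀ w : ℂ, r < ‖w‖ → P w := by
  rw [(hasBasis_cobounded_norm (E := ℂ)).eventually_iff]
  constructor
  · rintro ⟨r, -, h⟩
    exact ⟨max r 1, by positivity, fun w hw => h ((le_max_left _ _).trans hw.le)⟩
  · rintro ⟨r, -, h⟩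
    exact ⟨r + 1, trivial, fun w hw => h w (by have : r + 1 ≤ ‖w‖ := hw; linarith)⟩

theorem mem_outerComponent {K : Set ℂ} {z : ℂ} :
    z ∈ outerComponent K ↔ ∀ᶠ w in cobounded ℂ, JoinedIn Kᶜ z w := Iff.rfl

theorem outerComponent_subset_compl (K : Set ℂ) : outerComponent K ⊆ Kᶜ := by
  intro z hz
  obtain ⟨w, hw⟩ := (mem_outerComponent.1 hz).exists
  exact hw.source_mem

theorem mem_outerComponent_of_joinedIn {K : Set ℂ} {z w : ℂ} (h : JoinedIn Kᶜ z w)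
    (hw : w ∈ outerComponent K) : z ∈ outerComponent K :=
  (mem_outerComponent.1 hw).mono fun _ hv => h.trans hv

theorem mem_outerComponent_of_norm_gt {K : Set ℂ} {r : ℝ} (hr : 0 < r)
    (hK : K ⊆ closedBall 0 r) {z : ℂ} (hz : r < ‖z‖) : z ∈ outerComponent K := by
  refine eventually_cobounded_iff.2 ⟨r, hr, fun w hw => ?_⟩
  refine ((isPathConnected_norm_gt hr).joinedIn z hz w hw).mono fun v hv hvK => ?_
  have := hK hvK
  rw [mem_closedBall_zero_iff] at this
  exact (not_le.2 hv) this

theorem outerComponent_mono {K K' : Set ℂ} (h : K ⊆ K') : outerComponent K' ⊆ outerComponent K :=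
  fun _ hz => (mem_outerComponent.1 hz).mono fun _ hw => hw.mono (compl_subset_compl.2 h)

theorem isOpen_outerComponent {K : Set ℂ} (hK : IsClosed K) : IsOpen (outerComponent K) := by
  refine Metric.isOpen_iff.2 fun z hz => ?_
  obtain ⟨r, hr, hball⟩ := Metric.isOpen_iff.1 hK.isOpen_compl z (outerComponent_subset_compl K hz)
  refine ⟨r, hr, fun w hw => mem_outerComponent_of_joinedIn ?_ hz⟩
  exact ((isPathConnected_ball hr).joinedIn w hw z (mem_ball_self hr)).mono hball

theorem isPreconnected_outerComponent (K : Set ℂ) : IsPreconnected (outerComponent K) := by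
  refine isPreconnected_of_forall_pair fun x hx y hy => ?_
  obtain ⟨w, hxw, hyw⟩ := ((mem_outerComponent.1 hx).and (mem_outerComponent.1 hy)).exists
  obtain ⟨γ, hγ⟩ := hxw.trans hyw.symm
  refine ⟨range γ, ?_, ⟨0, γ.source⟩, ⟨1, γ.target⟩, isPreconnected_range γ.continuous⟩
  rintro _ ⟨t, rfl⟩
  -- every point of the path is joined to its endpoint `x`
  refine mem_outerComponent_of_joinedIn (JoinedIn.symm ?_) hx
  have : PathConnectedSpace unitInterval := isPathConnected_iff_pathConnectedSpace.1
    ((convex_Icc (0 : ℝ) 1).isPathConnected ⟨0, by simp⟩)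
  refine (isPathConnected_range γ.continuous).joinedIn x ⟨0, γ.source⟩ _ ⟨t, rfl⟩ |>.mono ?_
  rintro _ ⟨t, rfl⟩
  exact hγ t

/-- Removing countably many points from the unbounded component of a complement leaves it
connected, hence inside the unbounded component of the smaller complement. -/
theorem outerComponent_diff_subset {K K' : Set ℂ} (hK'c : IsClosed K') (hK : IsBounded K)
    (hcount : (K ∩ outerComponent K').Countable) (hK' : K' ⊆ K) :
    outerComponent K' \ K ⊆ outerComponent K := by
  rintro z ⟨hz, hzK⟩
  obtain ⟨r, hr, hKr⟩ := hK.subset_closedBall_lt 0 0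
  have hw : ∀ w : ℂ, r < ‖w‖ → w ∈ outerComponent K := fun w =>
    mem_outerComponent_of_norm_gt hr hKr
  refine eventually_cobounded_iff.2 ⟨r, hr, fun w hwr => ?_⟩
  have hwo := hw w hwr
  refine (joinedIn_diff_countable (isOpen_outerComponent hK'c) (isPreconnected_outerComponent K')
    hcount ⟨hz, fun h => hzK h.1⟩ ⟨outerComponent_mono hK' hwo,
      fun h => outerComponent_subset_compl K hwo h.1⟩).mono ?_
  exact fun v hv hvK => hv.2 ⟨hvK, hv.1⟩

theorem outerComponent_empty : outerComponent ∅ = univ := by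
  refine eq_univ_of_forall fun z => mem_outerComponent.2 (Eventually.of_forall fun w => ?_)
  rw [compl_empty, joinedIn_univ]
  exact PathConnectedSpace.joined z w

/-- The complement of a bounded countable set is connected. -/
theorem outerComponent_of_countable {K : Set ℂ} (hK : K.Countable) (hb : IsBounded K) :
    outerComponent K = Kᶜ := by
  refine (outerComponent_subset_compl K).antisymm fun z hz => ?_
  refine outerComponent_diff_subset isClosed_empty hb (hK.mono inter_subset_left)
    (empty_subset K) ⟨?_, hz⟩
  rw [outerComponent_empty]
  trivial

/-- Unbounded components depend continuously on decreasing families of closed sets, since paths are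
compact. -/
theorem outerComponent_iInter_subset {ι : Type*} [Nonempty ι] {K : ι → Set ℂ} {r : ℝ} (hr : 0 < r)
    (hcl : ∀ i, IsClosed (K i)) (hb : ∀ i, K i ⊆ closedBall 0 r) (hdir : Directed (· ⊇ ·) K) :
    outerComponent (⋂ i, K i) ⊆ ⋃ i, outerComponent (K i) := by
  intro z hz
  obtain ⟨s, -, hs⟩ := eventually_cobounded_iff.1 hz
  have hpos : 0 ≤ max r s := hr.le.trans (le_max_left _ _)
  have hnorm : ‖((max r s + 1 : ℝ) : ℂ)‖ = max r s + 1 := by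
    rw [Complex.norm_real, Real.norm_of_nonneg (by linarith)]
  obtain ⟨γ, hγ⟩ := hs ((max r s + 1 : ℝ) : ℂ) (by
    rw [hnorm]; linarith [le_max_right r s])
  have hcomp : IsCompact (range γ) := isCompact_range γ.continuous
  obtain ⟨i, hi⟩ := hcomp.elim_directed_family_closed K hcl (by
    rw [← disjoint_iff_inter_eq_empty, Set.disjoint_left]
    rintro _ ⟨t, rfl⟩ h
    exact hγ t h) hdir
  refine mem_iUnion.2 ⟨i, mem_outerComponent_of_joinedIn (w := ((max r s + 1 : ℝ) : ℂ)) ?_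
    (mem_outerComponent_of_norm_gt hr (hb i) (by rw [hnorm]; linarith [le_max_left r s]))⟩
  refine ⟨γ, fun t ht => ?_⟩
  have : γ t ∈ range γ ∩ K i := ⟨⟨t, rfl⟩, ht⟩
  rw [hi] at this
  exact this

theorem polyHull_mono {K K' : Set ℂ} (h : K ⊆ K') : polyHull K ⊆ polyHull K' :=
  fun _ hz p => (hz p).trans (biSup_mono h)

theorem subset_polyHull (K : Set ℂ) : K ⊆ polyHull K :=
  fun _ hz p => le_biSup (fun w => ‖p.eval w‖ₑ) hz

theorem polyHull_singleton_subset (c : ℂ) : polyHull {c} ⊆ {c} := by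
  intro z hz
  have := hz (Polynomial.X - Polynomial.C c)
  simpa [sub_eq_zero] using this

theorem polyHull_closure_subset (K : Set ℂ) : polyHull (closure K) ⊆ polyHull K := by
  intro z hz p
  refine (hz p).trans (iSup₂_le fun w hw => ?_)
  have hcl : IsClosed {w : ℂ | ‖p.eval w‖ₑ ≤ ⨆ w ∈ K, ‖p.eval w‖ₑ} :=
    isClosed_le p.continuous.enorm continuous_const
  exact closure_minimal (fun w hw => le_iSup₂ (f := fun w (_ : w ∈ K) => ‖p.eval w‖ₑ) w hw) hcl hw

/-- By the maximum modulus principle, the bounded components of the complement of a compact set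
lie in its polynomially convex hull. -/
theorem compl_outerComponent_subset_polyHull {K : Set ℂ} (hK : IsClosed K) (hb : IsBounded K) :
    (outerComponent K)ᶜ ⊆ polyHull K := by
  intro z hz
  by_cases hzK : z ∈ K
  · exact subset_polyHull K hzK
  intro p
  by_cases htop : (⨆ w ∈ K, ‖p.eval w‖ₑ) = ⊤
  · rw [htop]
    exact le_top
  obtain ⟨r, hr, hKr⟩ := hb.subset_closedBall_lt 0 0
  set W := connectedComponentIn Kᶜ z with hW
  have hWo : IsOpen W := hK.isOpen_compl.connectedComponentIn
  have hzW : z ∈ W := mem_connectedComponentIn hzK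
  have hWK : W ⊆ Kᶜ := connectedComponentIn_subset _ _
  have hWpc : IsPathConnected W := hWo.isConnected_iff_isPathConnected.1
    (isConnected_connectedComponentIn_iff.2 hzK)
  have hWb : W ⊆ closedBall 0 r := by
    intro w hw
    by_contra hwr
    rw [mem_closedBall_zero_iff, not_le] at hwr
    exact hz (mem_outerComponent_of_joinedIn ((hWpc.joinedIn z hzW w hw).mono hWK)
      (mem_outerComponent_of_norm_gt hr hKr hwr))
  have hfr : frontier W ⊆ K := by
    intro w hw
    by_contra hwK
    -- a ball around `w` in the complement of `K` meets `W`, hence lies in `W`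
    have hcl : w ∈ closure W := frontier_subset_closure hw
    have hwW : w ∉ W := by
      rw [hWo.frontier_eq] at hw
      exact hw.2
    have hV : connectedComponentIn Kᶜ w ∈ 𝓝 w :=
      hK.isOpen_compl.connectedComponentIn.mem_nhds (mem_connectedComponentIn hwK)
    obtain ⟨v, hv1, hv2⟩ := mem_closure_iff_nhds.1 hcl _ hV
    have e1 := connectedComponentIn_eq hv1
    have e2 := connectedComponentIn_eq hv2
    apply hwW
    rw [hW, e2, ← e1]
    exact mem_connectedComponentIn hwK
  have hbound := Complex.norm_le_of_forall_mem_frontier_norm_le (f := fun w => p.eval w)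
    (isBounded_closedBall.subset hWb) p.differentiable.diffContOnCl
    (C := (⨆ w ∈ K, ‖p.eval w‖ₑ).toReal) (fun w hw => by
      rw [← toReal_enorm]
      exact ENNReal.toReal_mono htop (le_biSup (fun w => ‖p.eval w‖ₑ) (hfr hw)))
    (subset_closure hzW)
  rw [← toReal_enorm] at hbound
  exact (ENNReal.toReal_le_toReal enorm_ne_top htop).1 hbound

/-- The fibres of a nonconstant analytic function are discrete, hence countable. -/
theorem countable_fiber_of_analytic {D : Set ℂ} (hD : IsOpen D) (hc : IsPreconnected D)
    {f : ℂ → ℂ} (hf : DifferentiableOn ℂ f D) {μ : ℂ} (hμ : μ ∈ D) {c : ℂ} (hne : f μ ≠ c) :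
    {z ∈ D | f z = c}.Countable := by
  have han : AnalyticOnNhd ℂ (fun z => f z - c) D :=
    (hf.sub_const c).analyticOnNhd hD
  refine countable_of_forall_nhdsWithin fun z hz => ?_
  rcases (han z hz.1).eventually_eq_zero_or_eventually_ne_zero with h | h
  · have := han.eqOn_zero_of_preconnected_of_eventuallyEq_zero hc hz.1 h hμ
    exact absurd (sub_eq_zero.1 this) hne
  · rw [eventually_nhdsWithin_iff] at h
    refine ⟨_, h, (countable_singleton z).mono ?_⟩
    rintro w ⟨hw, hw'⟩
    by_contra hwz
    exact hw' hwz (sub_eq_zero.2 hw.2)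

end ScatAlg

namespace ScatAlg

open Set Filter Topology Metric Bornology

/-! ### Analytic perturbations by elements of the socle -/

section Inessential

variable {Ω : Type*} [NormedRing Ω] [NormedAlgebra ℂ Ω]

/-- An element `s` of a unital Banach algebra is called inessential here if the analytic Fredholm
theorem holds for the multiples of `s`: an analytic family `1 - g(z)s` on a connected open set,
equal to `1` at some point, is invertible off a countable set. -/
def IsInessential (s : Ω) : Prop :=
  ∀ D : Set ℂ, IsOpen D → IsPreconnected D → ∀ g : ℂ → Ω, DifferentiableOn ℂ g D →
    ∀ μ ∈ D, g μ = 0 → {z ∈ D | ¬ IsUnit (1 - g z * s)}.Countable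

theorem IsInessential.zero : IsInessential (0 : Ω) := by
  intro D _ _ g _ μ _ _
  simp

/-- The first summand is dealt with on `D`, the second on what is left of `D`: this is still
connected because only countably many points have been removed. -/
theorem IsInessential.add [CompleteSpace Ω] {s t : Ω} (hs : IsInessential s)
    (ht : IsInessential t) : IsInessential (s + t) := by
  intro D hD hc g hg μ hμ hgμ
  set N := {z ∈ D | ¬ IsUnit (1 - g z * s)} with hN
  have hNc : N.Countable := hs D hD hc g hg μ hμ hgμ
  have hdiff : DifferentiableOn ℂ (fun z => 1 - g z * s) D :=
    (differentiableOn_const _).sub (hg.mul_const s)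
  have hDN : D \ N = D ∩ (fun z => 1 - g z * s) ⁻¹' {x | IsUnit x} := by
    ext z
    simp only [hN, Set.mem_sdiff, mem_inter_iff, mem_preimage, mem_ofPred_eq]
    tauto
  have hopen : IsOpen (D \ N) := by
    rw [hDN]
    exact hdiff.continuousOn.isOpen_inter_preimage hD Units.isOpen
  have hunit : ∀ z ∈ D \ N, IsUnit (1 - g z * s) := fun z hz => by
    rw [hDN] at hz
    exact hz.2
  have hμ' : μ ∈ D \ N := ⟨hμ, fun h => h.2 (by simp [hgμ])⟩
  let h : ℂ → Ω := fun z => Ring.inverse (1 - g z * s) * g z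
  have hh : DifferentiableOn ℂ h (D \ N) := by
    refine DifferentiableOn.mul (fun z hz => ?_) (hg.mono sdiff_subset)
    exact (differentiableAt_inverse (hunit z hz)).comp_differentiableWithinAt z
      ((hdiff z hz.1).mono sdiff_subset)
  have hcount := ht (D \ N) hopen (isPreconnected_diff_countable hD hc hNc) h hh μ hμ'
    (by simp [h, hgμ])
  refine (hNc.union hcount).mono ?_
  rintro z ⟨hz, hz'⟩
  by_cases hzN : z ∈ N
  · exact Or.inl hzN
  refine Or.inr ⟨⟨hz, hzN⟩, fun hu => hz' ?_⟩
  have hU := hunit z ⟨hz, hzN⟩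
  have e : 1 - g z * (s + t) = (1 - g z * s) * (1 - h z * t) := by
    simp only [h]
    rw [mul_sub, mul_one, mul_assoc, ← mul_assoc (1 - g z * s), Ring.mul_inverse_cancel _ hU,
      one_mul, mul_add]
    abel
  rw [e]
  exact hU.mul hu

/-- If `s Ω s ⊆ ℂ s`, then `1 - g s` is invertible unless a certain scalar analytic function of
`g` takes the value `1`. -/
theorem IsInessential.of_forall_mul_mul {s : Ω} (hs : ∀ b : Ω, ∃ c : ℂ, s * b * s = c • s) :
    IsInessential s := by
  by_cases hs0 : s = 0
  · rw [hs0]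
    exact IsInessential.zero
  intro D hD hc g hg μ hμ hgμ
  obtain ⟨f, -, hf⟩ := exists_dual_vector ℂ s (norm_ne_zero_iff.2 hs0)
  have hfs : f s ≠ 0 := by
    rw [hf]
    exact Complex.ofReal_ne_zero.2 (norm_ne_zero_iff.2 hs0)
  have hd : DifferentiableOn ℂ (fun z => f (s * g z * s)) D :=
    f.differentiable.comp_differentiableOn ((hg.const_mul s).mul_const s)
  refine (countable_fiber_of_analytic hD hc hd hμ (c := f s) ?_).mono ?_
  · simpa [hgμ] using hfs.symm
  · rintro z ⟨hz, hz'⟩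
    refine ⟨hz, ?_⟩
    by_contra hne
    obtain ⟨c, hcs⟩ := hs (g z)
    have hc1 : c ≠ 1 := by
      rintro rfl
      rw [one_smul] at hcs
      exact hne (by simp only [hcs])
    have hc1' : 1 - c ≠ 0 := sub_ne_zero.2 hc1.symm
    have hgg : g z * s * (g z * s) = c • (g z * s) := by
      rw [mul_assoc, ← mul_assoc s, hcs, mul_smul_comm]
    refine hz' (isUnit_iff_exists.2 ⟨1 + (1 - c)⁻¹ • (g z * s), ?_, ?_⟩)
    all_goals
      simp only [sub_mul, mul_add, add_mul, mul_sub, one_mul, mul_one, smul_mul_assoc,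
        mul_smul_comm, hgg, smul_smul, smul_sub]
      have : (1 - c)⁻¹ • (g z * s) - ((1 - c)⁻¹ * c) • (g z * s) = g z * s := by
        rw [← sub_smul, ← mul_one_sub, inv_mul_cancel₀ hc1', one_smul]
      generalize (1 - c)⁻¹ • (g z * s) = P at *
      generalize ((1 - c)⁻¹ * c) • (g z * s) = Q at *
      rw [← this]
      abel

end Inessential

section Fredholm

variable {Ω : Type*} [NormedRing Ω] [NormedAlgebra ℂ Ω] [CompleteSpace Ω]
  {E : Type*} [Ring E] [Algebra ℂ E]

/-- The kernel of `ρ` need not be closed: if `y` lifts the inverse of `ρ c`, then `c'` near `c` is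
congruent to `c (1 + y (c' - c))`, whose second factor is invertible. -/
theorem isOpen_setOf_isUnit_map (ρ : Ω →ₐ[ℂ] E) (hρ : Function.Surjective ρ) :
    IsOpen {c : Ω | IsUnit (ρ c)} := by
  refine isOpen_iff_mem_nhds.2 fun c hc => ?_
  obtain ⟨u, hu⟩ := (show IsUnit (ρ c) from hc)
  obtain ⟨y, hy⟩ := hρ (↑u⁻¹ : E)
  have hcont : Continuous fun c' : Ω => 1 + y * (c' - c) := by fun_prop
  have h1 : {c' : Ω | IsUnit (1 + y * (c' - c))} ∈ 𝓝 c :=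
    (Units.isOpen.preimage hcont).mem_nhds (by simp)
  filter_upwards [h1] with c' hc'
  have e : ρ c' = ρ c * ρ (1 + y * (c' - c)) := by
    simp only [map_add, map_one, map_mul, map_sub, hy, ← hu, mul_add, mul_sub]
    simp
  change IsUnit (ρ c')
  rw [e]
  exact hc.mul (hc'.map ρ)

theorem isClosed_spectrum_map (ρ : Ω →ₐ[ℂ] E) (hρ : Function.Surjective ρ) (x : Ω) :
    IsClosed (spectrum ℂ (ρ x)) := by
  rw [← isOpen_compl_iff]
  have hcont : Continuous fun z : ℂ => algebraMap ℂ Ω z - x := by fun_prop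
  convert (isOpen_setOf_isUnit_map ρ hρ).preimage hcont using 1
  ext z
  simp [spectrum.mem_iff]

/-- The Fredholm alternative: modulo an ideal of inessential elements, the spectrum
is at most countable in the unbounded component of the complement of the essential spectrum. -/
theorem countable_spectrum_inter_outerComponent (ρ : Ω →ₐ[ℂ] E) (hρ : Function.Surjective ρ)
    (hker : ∀ s, ρ s = 0 → IsInessential s) (x : Ω) :
    (spectrum ℂ x ∩ outerComponent (spectrum ℂ (ρ x))).Countable := by
  -- the points near which the spectrum is countable; this set is open and closed in the component
  let u : Set ℂ := {z | ∃ W ∈ 𝓝 z, (spectrum ℂ x ∩ W).Countable}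
  have hu : IsOpen u := by
    refine isOpen_iff_mem_nhds.2 fun z hz => ?_
    obtain ⟨W, hW, hWc⟩ := hz
    filter_upwards [eventually_mem_nhds_iff.2 hW] with w hw
    exact ⟨W, hw, hWc⟩
  suffices h : outerComponent (spectrum ℂ (ρ x)) ⊆ u by
    refine countable_of_forall_nhdsWithin fun z hz => ?_
    obtain ⟨W, hW, hWc⟩ := h hz.2
    exact ⟨W, hW, hWc.mono (inter_subset_inter_left _ inter_subset_left)⟩
  have hsub : spectrum ℂ (ρ x) ⊆ spectrum ℂ x := AlgHom.spectrum_apply_subset ρ x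
  refine (isPreconnected_outerComponent _).subset_of_closure_inter_subset hu ?_ ?_
  · obtain ⟨r, hr, hKr⟩ := (spectrum.isCompact (𝕜 := ℂ) x).isBounded.subset_closedBall_lt 0 0
    have hn : r < ‖((r + 1 : ℝ) : ℂ)‖ := by
      rw [Complex.norm_real, Real.norm_of_nonneg (by linarith)]
      linarith
    refine ⟨((r + 1 : ℝ) : ℂ), mem_outerComponent_of_norm_gt hr (hsub.trans hKr) hn, ?_⟩
    refine ⟨(spectrum ℂ x)ᶜ, (spectrum.isClosed (𝕜 := ℂ) x).isOpen_compl.mem_nhds fun h => ?_,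
      by simp⟩
    have := hKr h
    rw [mem_closedBall_zero_iff] at this
    exact (not_le.2 hn) this
  · rintro z₀ ⟨hz₀cl, hz₀⟩
    have hz₀u : IsUnit (ρ (algebraMap ℂ Ω z₀ - x)) := by
      have := outerComponent_subset_compl _ hz₀
      simpa [spectrum.mem_iff] using this
    obtain ⟨w₀, hw₀⟩ := hz₀u
    obtain ⟨y, hy⟩ := hρ (↑w₀⁻¹ : E)
    -- `y * (v z)⁻¹` is an analytic family of inverses of `z - x` modulo the kernel
    let v : ℂ → Ω := fun z => 1 + (z - z₀) • y
    have hvd : Differentiable ℂ v := by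
      refine (differentiable_const _).add ?_
      exact (differentiable_id.sub_const _).smul_const y
    have hvo : {z | IsUnit (v z)} ∈ 𝓝 z₀ :=
      (Units.isOpen.preimage hvd.continuous).mem_nhds (by simp [v])
    obtain ⟨r, hr, hball⟩ := Metric.mem_nhds_iff.1 hvo
    -- a point `μ` of the resolvent set in the ball around `z₀`
    obtain ⟨μ, hμb, hμ⟩ : ∃ μ ∈ ball z₀ r, μ ∉ spectrum ℂ x := by
      obtain ⟨z₁, hz₁b, W, hW, hWc⟩ := mem_closure_iff_nhds.1 hz₀cl _ (ball_mem_nhds z₀ hr)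
      obtain ⟨μ, hμ, hμn⟩ := mem_closure_iff_nhds.1 (hWc.dense_compl ℝ z₁) _
        (inter_mem (isOpen_ball.mem_nhds hz₁b) hW)
      exact ⟨μ, hμ.1, fun h => hμn ⟨h, hμ.2⟩⟩
    have haμ : IsUnit (algebraMap ℂ Ω μ - x) := by simpa [spectrum.mem_iff] using hμ
    have hvμ : IsUnit (v μ) := hball hμb
    set a := Ring.inverse (algebraMap ℂ Ω μ - x) with ha
    set q := Ring.inverse (v μ) with hq
    have hcomm : y * v μ = v μ * y := by simp [v, mul_add, add_mul]
    -- `a` and `y * q` are both inverse to `μ - x` modulo the kernel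
    have hs : ρ (a - y * q) = 0 := by
      have h1 : ρ a * ρ (algebraMap ℂ Ω μ - x) = 1 := by
        rw [← map_mul, ha, Ring.inverse_mul_cancel _ haμ, map_one]
      have h2 : ρ (algebraMap ℂ Ω μ - x) * ρ (y * q) = 1 := by
        have e1 : algebraMap ℂ Ω μ - x = (algebraMap ℂ Ω z₀ - x) + (μ - z₀) • 1 := by
          rw [Algebra.algebraMap_eq_smul_one, Algebra.algebraMap_eq_smul_one, sub_smul]
          abel
        have e2 : ρ (algebraMap ℂ Ω μ - x) = ρ (algebraMap ℂ Ω z₀ - x) * ρ (v μ) := by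
          rw [e1]
          simp only [v, map_add, map_one, map_smul, mul_add, mul_one, mul_smul_comm, hy, ← hw₀,
            Units.mul_inv]
        rw [e2, mul_assoc, ← map_mul, ← mul_assoc, ← hcomm, mul_assoc, hq,
          Ring.mul_inverse_cancel _ hvμ, mul_one, hy, ← hw₀, Units.mul_inv]
      rw [map_sub, sub_eq_zero]
      exact left_inv_eq_right_inv h1 h2
    let g : ℂ → Ω := fun z => -((z - μ) • (v μ * Ring.inverse (v z)))
    have hg : DifferentiableOn ℂ g (ball z₀ r) := by
      refine DifferentiableOn.fun_neg
        (DifferentiableOn.fun_smul ?_ (DifferentiableOn.const_mul ?_ _))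
      · exact (differentiable_id.sub_const μ).differentiableOn
      · intro z hz
        exact ((differentiableAt_inverse (hball hz)).comp z (hvd z)).differentiableWithinAt
    refine ⟨ball z₀ r, ball_mem_nhds z₀ hr, ?_⟩
    refine ((hker _ hs) (ball z₀ r) isOpen_ball isPreconnected_ball g hg μ hμb
      (by simp [g])).mono ?_
    rintro z ⟨hz, hzb⟩
    refine ⟨hzb, fun hun => hz ?_⟩
    have hvz : IsUnit (v z) := hball hzb
    have e : algebraMap ℂ Ω z - x =
        (algebraMap ℂ Ω μ - x) * (v z * q * (1 - g z * (a - y * q))) := by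
      have e1 : algebraMap ℂ Ω z - x = (algebraMap ℂ Ω μ - x) * (1 + (z - μ) • a) := by
        rw [mul_add, mul_one, mul_smul_comm, ha, Ring.mul_inverse_cancel _ haμ,
          Algebra.algebraMap_eq_smul_one, Algebra.algebraMap_eq_smul_one, sub_smul]
        abel
      have e2 : v z * q * g z = -((z - μ) • 1) := by
        simp only [g, mul_neg, mul_smul_comm]
        rw [mul_assoc, ← mul_assoc q, hq, Ring.inverse_mul_cancel _ hvμ, one_mul,
          Ring.mul_inverse_cancel _ hvz]
      have e3 : v z * q = 1 + (z - μ) • (y * q) := by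
        have : v z = v μ + (z - μ) • y := by
          simp only [v, sub_smul]
          abel
        rw [this, add_mul, hq, Ring.mul_inverse_cancel _ hvμ, smul_mul_assoc]
      rw [e1, mul_sub, ← mul_assoc (v z * q), e2, e3]
      simp only [mul_one, neg_mul, smul_mul_assoc, one_mul, smul_sub]
      congr 1
      abel
    rw [spectrum.mem_resolventSet_iff, e]
    exact haμ.mul ((hvz.mul (by
      rw [hq]
      exact hvμ.ringInverse)).mul hun)

end Fredholm

end ScatAlg

namespace ScatAlg

open Set Filter Topology Metric Bornology

/-! ### Corners and minimal left ideals -/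

section Corner

variable {Ω : Type*} [NormedRing Ω] [NormedAlgebra ℂ Ω]

/-- The elements `x` with `e x = x = x e`. For an idempotent `e` this is the corner `e Ω e`. -/
def cornerSubalgebra (e : Ω) : NonUnitalSubalgebra ℂ Ω where
  carrier := {x | e * x = x ∧ x * e = x}
  add_mem' := by
    rintro a b ⟨ha, ha'⟩ ⟨hb, hb'⟩
    exact ⟨by rw [mul_add, ha, hb], by rw [add_mul, ha', hb']⟩
  zero_mem' := by simp
  mul_mem' := by
    rintro a b ⟨ha, ha'⟩ ⟨hb, hb'⟩
    exact ⟨by rw [← mul_assoc, ha], by rw [mul_assoc, hb']⟩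
  smul_mem' := by
    rintro z a ⟨ha, ha'⟩
    exact ⟨by rw [mul_smul_comm, ha], by rw [smul_mul_assoc, ha']⟩

/-- The corner `e Ω e` of an idempotent `e`, as a Banach algebra with identity element `e`. Its
identity element need not have norm one. -/
def Corner {e : Ω} (_ : IsIdempotentElem e) : Type _ := cornerSubalgebra e

namespace Corner

variable {e : Ω} (he : IsIdempotentElem e)

noncomputable instance : NonUnitalNormedRing (Corner he) :=
  inferInstanceAs (NonUnitalNormedRing (cornerSubalgebra e))

noncomputable instance : Module ℂ (Corner he) := inferInstanceAs (Module ℂ (cornerSubalgebra e))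

noncomputable instance : NormedRing (Corner he) :=
  { (inferInstance : NonUnitalNormedRing (Corner he)) with
    one := ⟨e, he, he⟩
    one_mul := fun x => Subtype.ext x.2.1
    mul_one := fun x => Subtype.ext x.2.2 }

noncomputable instance : Algebra ℂ (Corner he) :=
  Algebra.ofModule (fun z x y => Subtype.ext (smul_mul_assoc z (x.1 : Ω) (y.1 : Ω)))
    (fun z x y => Subtype.ext (mul_smul_comm z (x.1 : Ω) (y.1 : Ω)))

noncomputable instance : NormedAlgebra ℂ (Corner he) where
  norm_smul_le z x := norm_smul_le z (x.1 : Ω)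

/-- The inclusion of a corner. -/
def val (x : Corner he) : Ω := x.1

theorem val_injective : Function.Injective (val he) := Subtype.val_injective

theorem val_mul (x y : Corner he) : val he (x * y) = val he x * val he y := rfl

theorem val_sub (x y : Corner he) : val he (x - y) = val he x - val he y := rfl

theorem val_smul (z : ℂ) (x : Corner he) : val he (z • x) = z • val he x := rfl

theorem val_one : val he 1 = e := rfl

theorem val_zero : val he 0 = 0 := rfl

theorem mul_val (x : Corner he) : e * val he x = val he x := x.2.1

theorem val_mul_self (x : Corner he) : val he x * e = val he x := x.2.2

theorem exists_val_eq {x : Ω} (h1 : e * x = x) (h2 : x * e = x) : ∃ y, val he y = x :=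
  ⟨⟨x, h1, h2⟩, rfl⟩

theorem exists_val_eq_mul_mul (x : Ω) : ∃ y, val he y = e * x * e :=
  exists_val_eq he (by rw [← mul_assoc, ← mul_assoc, he]) (by rw [mul_assoc _ e e, he])

theorem val_algebraMap (z : ℂ) : val he (algebraMap ℂ _ z) = z • e := by
  rw [Algebra.algebraMap_eq_smul_one, val_smul, val_one]

instance [CompleteSpace Ω] : CompleteSpace (Corner he) := by
  have hcl : IsClosed ((cornerSubalgebra e : NonUnitalSubalgebra ℂ Ω) : Set Ω) := by
    have h1 : IsClosed {x : Ω | e * x = x} := isClosed_eq (by fun_prop) (by fun_prop)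
    have h2 : IsClosed {x : Ω | x * e = x} := isClosed_eq (by fun_prop) (by fun_prop)
    exact h1.inter h2
  exact hcl.completeSpace_coe

theorem nontrivial (h0 : e ≠ 0) : Nontrivial (Corner he) :=
  ⟨1, 0, fun h => h0 (congrArg (val he) h)⟩

theorem isUnit_iff (x : Corner he) :
    IsUnit x ↔ ∃ y : Ω, e * y * e = y ∧ val he x * y = e ∧ y * val he x = e := by
  constructor
  · rintro ⟨u, rfl⟩
    refine ⟨val he ↑u⁻¹, ?_, ?_, ?_⟩
    · rw [mul_val, val_mul_self]
    · rw [← val_mul, Units.mul_inv, val_one]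
    · rw [← val_mul, Units.inv_mul, val_one]
  · rintro ⟨y, hy, h1, h2⟩
    obtain ⟨w, hw⟩ := exists_val_eq_mul_mul he y
    rw [hy] at hw
    subst hw
    exact isUnit_iff_exists.2 ⟨w, val_injective he h1, val_injective he h2⟩

theorem spectrum_subset (x : Corner he) : spectrum ℂ x ⊆ spectrum ℂ (val he x) := by
  intro z hz hu
  rw [spectrum.mem_resolventSet_iff] at hu
  obtain ⟨u, hu⟩ := hu
  refine hz ?_
  rw [spectrum.mem_resolventSet_iff, isUnit_iff, val_sub, val_algebraMap]
  have hcomm : e * (u : Ω) = u * e := by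
    rw [hu, mul_sub, sub_mul, mul_val, val_mul_self, Algebra.commutes]
  have hcomm' : e * (↑u⁻¹ : Ω) = ↑u⁻¹ * e := by
    rw [Units.mul_inv_eq_iff_eq_mul, mul_assoc, hcomm, ← mul_assoc, Units.inv_mul, one_mul]
  have hx : z • e - val he x = e * u := by
    rw [hu, mul_sub, mul_val, Algebra.algebraMap_eq_smul_one, mul_smul_comm, mul_one]
  refine ⟨e * ↑u⁻¹, ?_, ?_, ?_⟩
  · rw [mul_assoc, mul_assoc, ← hcomm', ← mul_assoc e e, he, ← mul_assoc, he]
  · rw [hx, hcomm, mul_assoc, ← mul_assoc e e, he, hcomm', ← mul_assoc, Units.mul_inv, one_mul]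
  · rw [hx, hcomm', mul_assoc, ← mul_assoc e e, he, hcomm, ← mul_assoc, Units.inv_mul, one_mul]

end Corner

end Corner

section Schur

variable {Ω : Type*} [NormedRing Ω] [NormedAlgebra ℂ Ω] [CompleteSpace Ω]

/-- Right multiplication by an element of a minimal left ideal `L` is a scalar on `L`. Otherwise, by
Schur's lemma, `L` would contain an idempotent `e` and an element of the corner `e Ω e` with empty
spectrum. -/
theorem exists_mul_eq_smul_of_isAtom {L : Ideal Ω} (hL : IsAtom L) {c : Ω} (hc : c ∈ L) :
    ∃ z : ℂ, ∀ t ∈ L, t * c = z • t := by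
  have : IsSimpleModule Ω L := isSimpleModule_iff_isAtom.2 hL
  have hsm : ∀ (z : ℂ) {t : Ω}, t ∈ L → z • t ∈ L := fun z t ht => by
    rw [← one_mul t, ← smul_mul_assoc]
    exact L.mul_mem_left _ ht
  by_contra! hne
  let T : ℂ → L →ₗ[Ω] L := fun z =>
    { toFun := fun t => ⟨t * c - z • (t : Ω), L.sub_mem (L.mul_mem_left _ hc) (hsm z t.2)⟩
      map_add' := fun a b => Subtype.ext (by
        simp only [Submodule.coe_add, add_mul, smul_add]; abel)
      map_smul' := fun a b => Subtype.ext (by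
        simp [mul_sub, mul_assoc]) }
  have hT : ∀ z, Function.Bijective (T z) := fun z => by
    refine (LinearMap.bijective_or_eq_zero (T z)).resolve_right fun h => ?_
    obtain ⟨t, ht, htz⟩ := hne z
    have := congrArg Subtype.val (LinearMap.congr_fun h ⟨t, ht⟩)
    exact htz (sub_eq_zero.1 this)
  have hinj : ∀ (z : ℂ) {t : Ω}, t ∈ L → t * c = z • t → t = 0 := fun z t ht h => by
    have : (⟨t, ht⟩ : L) = 0 := (hT z).1 (by
      rw [map_zero]
      exact Subtype.ext (sub_eq_zero.2 h))
    exact congrArg Subtype.val this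
  have hsurj : ∀ (z : ℂ) {t : Ω}, t ∈ L → ∃ d ∈ L, d * c - z • d = t := fun z t ht => by
    obtain ⟨d, hd⟩ := (hT z).2 ⟨t, ht⟩
    exact ⟨d, d.2, congrArg Subtype.val hd⟩
  have hinj0 : ∀ {t : Ω}, t ∈ L → t * c = 0 → t = 0 := fun ht h => hinj 0 ht (by rw [h, zero_smul])
  obtain ⟨e, heL, hec⟩ := hsurj 0 hc
  rw [zero_smul, sub_zero] at hec
  have he : IsIdempotentElem e := by
    refine sub_eq_zero.1 (hinj0 (L.sub_mem (L.mul_mem_left _ heL) heL) ?_)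
    rw [sub_mul, mul_assoc, hec, hec, sub_self]
  have hce : c * e = c := by
    refine sub_eq_zero.1 (hinj0 (L.sub_mem (L.mul_mem_left _ heL) hc) ?_)
    rw [sub_mul, mul_assoc, hec, sub_self]
  have he0 : e ≠ 0 := by
    rintro rfl
    rw [zero_mul] at hec
    obtain ⟨t, ht, ht'⟩ := hne 0
    rw [← hec, mul_zero, zero_smul] at ht'
    exact ht' rfl
  have := Corner.nontrivial he he0
  obtain ⟨w, hw⟩ := Corner.exists_val_eq he hec hce
  obtain ⟨z, hz⟩ := spectrum.nonempty w
  refine hz ?_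
  rw [spectrum.mem_resolventSet_iff, IsUnit.sub_iff, Corner.isUnit_iff, Corner.val_sub,
    Corner.val_algebraMap, hw]
  obtain ⟨d, hd, hdc⟩ := hsurj z heL
  have hde : d * e = d := by
    refine sub_eq_zero.1 (hinj0 (L.sub_mem (L.mul_mem_left _ heL) hd) ?_)
    rw [sub_mul, mul_assoc, hec, sub_self]
  have hleft : e * d * (c - z • e) = e := by
    rw [mul_assoc, mul_sub, mul_smul_comm, hde, hdc, he]
  refine ⟨e * d, ?_, ?_, hleft⟩
  · rw [← mul_assoc, he, mul_assoc, hde]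
  · -- the right inverse property, by injectivity of right multiplication by `c - z`
    have huL : (c - z • e) * (e * d) - e ∈ L :=
      L.sub_mem (L.mul_mem_left _ (L.mul_mem_left _ hd)) heL
    refine sub_eq_zero.1 (hinj z huL ?_)
    have h1 : ((c - z • e) * (e * d) - e) * (c - z • e) = 0 := by
      rw [sub_mul, mul_assoc, hleft, sub_mul, hce, smul_mul_assoc, he, mul_sub, hec,
        mul_smul_comm, he, sub_self]
    have h2 : ((c - z • e) * (e * d) - e) * e = (c - z • e) * (e * d) - e := by
      rw [sub_mul, mul_assoc, mul_assoc, hde, he]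
    rw [mul_sub, mul_smul_comm, h2, sub_eq_zero] at h1
    exact h1

theorem isInessential_of_isAtom {L : Ideal Ω} (hL : IsAtom L) {s : Ω} (hs : s ∈ L) :
    IsInessential s := by
  refine IsInessential.of_forall_mul_mul fun b => ?_
  obtain ⟨z, hz⟩ := exists_mul_eq_smul_of_isAtom hL (L.mul_mem_left b hs)
  exact ⟨z, by rw [mul_assoc, hz s hs]⟩

end Schur

end ScatAlg

namespace ScatAlg

open Set Filter Topology Metric Bornology

/-! ### Idempotents from countable spectrum -/

section RingInverse

variable {R : Type*} [Ring R]

theorem ringInverse_eq_of_mul_eq_one {x y : R} (hx : IsUnit x) (h : x * y = 1) :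
    Ring.inverse x = y :=
  hx.mul_left_cancel (by rw [Ring.mul_inverse_cancel _ hx, h])

theorem ringInverse_sub_ringInverse {x y : R} (hx : IsUnit x) (hy : IsUnit y) :
    Ring.inverse x - Ring.inverse y = Ring.inverse x * (y - x) * Ring.inverse y := by
  rw [mul_sub, sub_mul, mul_assoc, Ring.mul_inverse_cancel _ hy, mul_one,
    Ring.inverse_mul_cancel _ hx, one_mul]

theorem ringInverse_one_sub_mul_one_add {a : R} (h1 : IsUnit (1 - a)) (h2 : IsUnit (1 + a)) :
    Ring.inverse (1 - a * a) = Ring.inverse (1 - a) * Ring.inverse (1 + a) := by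
  have e : 1 - a * a = (1 + a) * (1 - a) := by noncomm_ring
  rw [e]
  refine ringInverse_eq_of_mul_eq_one (h2.mul h1) ?_
  rw [mul_assoc, ← mul_assoc (1 - a), Ring.mul_inverse_cancel _ h1, one_mul,
    Ring.mul_inverse_cancel _ h2]

theorem ringInverse_one_sub_add_ringInverse_one_add {a : R} (h1 : IsUnit (1 - a))
    (h2 : IsUnit (1 + a)) :
    Ring.inverse (1 - a) + Ring.inverse (1 + a) =
      2 * (Ring.inverse (1 - a) * Ring.inverse (1 + a)) := by
  have e : (2 : R) = (1 - a) + (1 + a) := by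
    rw [sub_add_add_cancel, one_add_one_eq_two]
  have h : (1 + a) * Ring.inverse (1 - a) = Ring.inverse (1 - a) * (1 + a) := by
    refine h1.mul_left_cancel ?_
    rw [← mul_assoc, ← mul_assoc (1 - a) (Ring.inverse _), Ring.mul_inverse_cancel _ h1, one_mul,
      show (1 - a) * (1 + a) = (1 + a) * (1 - a) by noncomm_ring, mul_assoc,
      Ring.mul_inverse_cancel _ h1, mul_one]
  rw [e, add_mul, ← mul_assoc, ← mul_assoc, Ring.mul_inverse_cancel _ h1, one_mul, h, mul_assoc,
    Ring.mul_inverse_cancel _ h2, mul_one, add_comm]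

theorem isUnit_smul_iff_of_ne_zero [Algebra ℂ R] {a : ℂ} {x : R} (ha : a ≠ 0) :
    IsUnit (a • x) ↔ IsUnit x :=
  isUnit_smul_iff (Units.mk0 a ha) x

end RingInverse

section Riesz

variable {Ω : Type*} [NormedRing Ω] [NormedAlgebra ℂ Ω] [CompleteSpace Ω]

theorem exists_norm_ringInverse_le {c : Ω} (hc : ∀ w : ℂ, ‖w‖ = 1 → IsUnit (1 - w • c)) :
    ∃ M : ℝ, 0 ≤ M ∧ ∀ w : ℂ, ‖w‖ = 1 → ‖Ring.inverse (1 - w • c)‖ ≤ M := by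
  have hcont : ContinuousOn (fun w : ℂ => Ring.inverse (1 - w • c)) (sphere 0 1) := by
    intro w hw
    have h1 : DifferentiableAt ℂ (fun w : ℂ => 1 - w • c) w := by fun_prop
    exact ((differentiableAt_inverse (𝕜 := ℂ) (hc w (by simpa using hw))).comp w
      h1).continuousAt.continuousWithinAt
  obtain ⟨M, hM⟩ := (isCompact_sphere (0 : ℂ) 1).exists_bound_of_continuousOn hcont
  exact ⟨max M 0, le_max_right _ _, fun w hw => (hM w (by simpa using hw)).trans (le_max_left _ _)⟩

theorem norm_exp_I_sub_exp_I_le (s t : ℝ) :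
    ‖Complex.exp (Complex.I * s) - Complex.exp (Complex.I * t)‖ ≤ |s - t| := by
  have e : Complex.exp (Complex.I * s) - Complex.exp (Complex.I * t) =
      Complex.exp (Complex.I * t) * (Complex.exp (Complex.I * ((s - t : ℝ) : ℂ)) - 1) := by
    rw [mul_sub, ← Complex.exp_add, mul_one]
    congr 2
    push_cast
    ring
  rw [e, norm_mul, mul_comm Complex.I (t : ℂ), Complex.norm_exp_ofReal_mul_I, one_mul]
  exact Real.norm_exp_I_mul_ofReal_sub_one_le

theorem norm_exp_I_mul (t : ℝ) : ‖Complex.exp (Complex.I * t)‖ = 1 := by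
  rw [mul_comm, Complex.norm_exp_ofReal_mul_I]

section Iterates

variable {c : Ω} (hc : ∀ w : ℂ, ‖w‖ = 1 → IsUnit (1 - w • c))

omit [CompleteSpace Ω] in
theorem exp_half_smul_sq (k : ℕ) (t : ℝ) :
    Complex.exp (Complex.I * t) • c ^ 2 ^ (k + 1) =
      (Complex.exp (Complex.I * (t / 2 : ℝ)) • c ^ 2 ^ k) *
        (Complex.exp (Complex.I * (t / 2 : ℝ)) • c ^ 2 ^ k) := by
  rw [smul_mul_smul_comm, ← Complex.exp_add, ← pow_add]
  congr 2
  · push_cast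
    ring
  · ring

omit [CompleteSpace Ω] in
theorem one_add_exp_half_smul (k : ℕ) (t : ℝ) :
    1 + Complex.exp (Complex.I * (t / 2 : ℝ)) • c ^ 2 ^ k =
      1 - Complex.exp (Complex.I * (t / 2 + Real.pi : ℝ)) • c ^ 2 ^ k := by
  have : Complex.exp (Complex.I * (t / 2 + Real.pi : ℝ)) =
      -Complex.exp (Complex.I * (t / 2 : ℝ)) := by
    rw [Complex.ofReal_add, mul_add, Complex.exp_add, mul_comm Complex.I (Real.pi : ℂ),
      Complex.exp_pi_mul_I, mul_neg_one]
  rw [this, neg_smul, sub_neg_eq_add]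

include hc

omit [CompleteSpace Ω] in
theorem isUnit_one_sub_exp_smul_pow (k : ℕ) (t : ℝ) :
    IsUnit (1 - Complex.exp (Complex.I * t) • c ^ 2 ^ k) := by
  induction k generalizing t with
  | zero =>
    rw [pow_zero, pow_one]
    exact hc _ (norm_exp_I_mul t)
  | succ k ih =>
    rw [exp_half_smul_sq, show ∀ a : Ω, 1 - a * a = (1 - a) * (1 + a) from fun a => by noncomm_ring,
      one_add_exp_half_smul]
    exact (ih _).mul (ih _)

omit [CompleteSpace Ω] in
theorem ringInverse_exp_smul_pow_succ (k : ℕ) (t : ℝ) :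
    Ring.inverse (1 - Complex.exp (Complex.I * t) • c ^ 2 ^ (k + 1)) =
      Ring.inverse (1 - Complex.exp (Complex.I * (t / 2 : ℝ)) • c ^ 2 ^ k) *
        Ring.inverse (1 - Complex.exp (Complex.I * (t / 2 + Real.pi : ℝ)) • c ^ 2 ^ k) := by
  have h1 := isUnit_one_sub_exp_smul_pow hc k (t / 2)
  have h2 := isUnit_one_sub_exp_smul_pow hc k (t / 2 + Real.pi)
  rw [← one_add_exp_half_smul] at h2 ⊢
  rw [exp_half_smul_sq, ringInverse_one_sub_mul_one_add h1 h2]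

omit [CompleteSpace Ω] in
theorem two_mul_ringInverse_exp_smul_pow_succ (k : ℕ) (t : ℝ) :
    2 * Ring.inverse (1 - Complex.exp (Complex.I * t) • c ^ 2 ^ (k + 1)) =
      Ring.inverse (1 - Complex.exp (Complex.I * (t / 2 : ℝ)) • c ^ 2 ^ k) +
        Ring.inverse (1 - Complex.exp (Complex.I * (t / 2 + Real.pi : ℝ)) • c ^ 2 ^ k) := by
  have h1 := isUnit_one_sub_exp_smul_pow hc k (t / 2)
  have h2 := isUnit_one_sub_exp_smul_pow hc k (t / 2 + Real.pi)
  rw [ringInverse_exp_smul_pow_succ hc]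
  rw [← one_add_exp_half_smul] at h2 ⊢
  rw [ringInverse_one_sub_add_ringInverse_one_add h1 h2]

/-- Each step `c ↦ c²` halves the Lipschitz constant of the resolvent along the unit circle: with
`w ^ 2 = z`, the value `(1 - z c²)⁻¹` is the mean of `(1 - w c)⁻¹` and `(1 + w c)⁻¹`. -/
theorem exists_lipschitz_ringInverse_pow : ∃ L : ℝ, 0 ≤ L ∧ ∀ (k : ℕ) (s t : ℝ),
    ‖Ring.inverse (1 - Complex.exp (Complex.I * s) • c ^ 2 ^ k) -
      Ring.inverse (1 - Complex.exp (Complex.I * t) • c ^ 2 ^ k)‖ ≤ L / 2 ^ k * |s - t| := by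
  obtain ⟨M, hM0, hM⟩ := exists_norm_ringInverse_le hc
  refine ⟨M * ‖c‖ * M, by positivity, fun k => ?_⟩
  induction k with
  | zero =>
    intro s t
    rw [pow_zero, pow_one, pow_zero, div_one, ringInverse_sub_ringInverse (hc _ (norm_exp_I_mul s))
      (hc _ (norm_exp_I_mul t)), sub_sub_sub_cancel_left, ← sub_smul]
    calc _ ≤ ‖Ring.inverse (1 - Complex.exp (Complex.I * s) • c)‖ *
          ‖(Complex.exp (Complex.I * s) - Complex.exp (Complex.I * t)) • c‖ *
          ‖Ring.inverse (1 - Complex.exp (Complex.I * t) • c)‖ :=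
            (norm_mul_le _ _).trans (by gcongr; exact norm_mul_le _ _)
      _ ≤ M * (|s - t| * ‖c‖) * M := by
        rw [norm_smul]
        gcongr
        · exact hM _ (norm_exp_I_mul s)
        · exact norm_exp_I_sub_exp_I_le s t
        · exact hM _ (norm_exp_I_mul t)
      _ = _ := by ring
  | succ k ih =>
    intro s t
    have key : (2 : ℂ) • (Ring.inverse (1 - Complex.exp (Complex.I * s) • c ^ 2 ^ (k + 1)) -
        Ring.inverse (1 - Complex.exp (Complex.I * t) • c ^ 2 ^ (k + 1))) =
        (Ring.inverse (1 - Complex.exp (Complex.I * (s / 2 : ℝ)) • c ^ 2 ^ k) -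
          Ring.inverse (1 - Complex.exp (Complex.I * (t / 2 : ℝ)) • c ^ 2 ^ k)) +
        (Ring.inverse (1 - Complex.exp (Complex.I * (s / 2 + Real.pi : ℝ)) • c ^ 2 ^ k) -
          Ring.inverse (1 - Complex.exp (Complex.I * (t / 2 + Real.pi : ℝ)) • c ^ 2 ^ k)) := by
      rw [ofNat_smul_eq_nsmul ℂ, nsmul_eq_mul, Nat.cast_ofNat, mul_sub,
        two_mul_ringInverse_exp_smul_pow_succ hc, two_mul_ringInverse_exp_smul_pow_succ hc]
      abel
    have h2 := congrArg norm key
    rw [norm_smul, Complex.norm_ofNat] at h2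
    have h3 := (norm_add_le _ _).trans (add_le_add (ih (s / 2) (t / 2))
      (ih (s / 2 + Real.pi) (t / 2 + Real.pi)))
    rw [← h2, add_sub_add_right_eq_sub, ← sub_div, abs_div, abs_two] at h3
    have : M * ‖c‖ * M / 2 ^ (k + 1) * |s - t| =
        (M * ‖c‖ * M / 2 ^ k * (|s - t| / 2) + M * ‖c‖ * M / 2 ^ k * (|s - t| / 2)) / 2 := by
      rw [pow_succ]
      field_simp
      ring
    rw [this]
    linarith

end Iterates

/-- The Riesz idempotent `p = lim (1 - c ^ 2 ^ k)⁻¹` belonging to the part of the spectrum of `c`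
inside the unit circle, when the circle itself is disjoint from the spectrum. -/
theorem exists_isIdempotentElem_of_unitCircle {c : Ω}
    (hc : ∀ w : ℂ, ‖w‖ = 1 → IsUnit (1 - w • c)) :
    ∃ p : Ω, IsIdempotentElem p ∧ (∃ y, 1 - p = c * y) ∧
      ((∃ z ∈ spectrum ℂ c, ‖z‖ < 1) → p ≠ 0) ∧ ((∃ z ∈ spectrum ℂ c, 1 < ‖z‖) → p ≠ 1) := by
  obtain ⟨L, hL0, hL⟩ := exists_lipschitz_ringInverse_pow hc
  let f : ℕ → Ω := fun k => Ring.inverse (1 - c ^ 2 ^ k)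
  have hf : ∀ k, f k = Ring.inverse (1 - Complex.exp (Complex.I * (0 : ℝ)) • c ^ 2 ^ k) := by
    intro k
    simp [f]
  have hu : ∀ k, IsUnit (1 - c ^ 2 ^ k) := fun k => by
    simpa using isUnit_one_sub_exp_smul_pow hc k 0
  have hfu : ∀ k, IsUnit (f k) := fun k => (hu k).ringInverse
  let g : ℕ → Ω := fun k =>
    Ring.inverse (1 - Complex.exp (Complex.I * (0 / 2 + Real.pi : ℝ)) • c ^ 2 ^ k)
  have hmul : ∀ k, f (k + 1) = f k * g k := fun k => by
    simp only [hf, ringInverse_exp_smul_pow_succ hc, zero_div, g]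
  have hadd : ∀ k, 2 * f (k + 1) = f k + g k := fun k => by
    simp only [hf, two_mul_ringInverse_exp_smul_pow_succ hc, zero_div, g]
  have hcauchy : CauchySeq f := by
    refine cauchySeq_of_le_geometric_two (C := L * Real.pi) fun k => ?_
    have e : (2 : ℂ) • (f k - f (k + 1)) = f k - g k := by
      rw [ofNat_smul_eq_nsmul ℂ, nsmul_eq_mul, Nat.cast_ofNat, mul_sub, hadd, two_mul]
      abel
    have h2 := congrArg norm e
    rw [norm_smul, Complex.norm_ofNat] at h2
    have h3 := hL k 0 (0 / 2 + Real.pi)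
    rw [← hf] at h3
    change ‖f k - g k‖ ≤ _ at h3
    have h4 : |(0 : ℝ) - (0 / 2 + Real.pi)| = Real.pi := by
      rw [zero_div, zero_add, zero_sub, abs_neg, abs_of_pos Real.pi_pos]
    rw [h4] at h3
    rw [dist_eq_norm]
    have : L * Real.pi / 2 / 2 ^ k = L / 2 ^ k * Real.pi / 2 := by ring
    rw [this]
    linarith
  obtain ⟨p, hp⟩ := cauchySeq_tendsto_of_complete hcauchy
  have hp1 : Tendsto (fun k => f (k + 1)) atTop (𝓝 p) := hp.comp (tendsto_add_atTop_nat 1)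
  have hidem : IsIdempotentElem p := by
    -- eliminate `g` from the formulas for the product and the sum, and pass to the limit
    have h1 : ∀ k, f (k + 1) = f k * (2 * f (k + 1) - f k) := fun k => by
      rw [hadd, add_sub_cancel_left, hmul]
    have h2 : Tendsto (fun k => f k * (2 * f (k + 1) - f k)) atTop (𝓝 (p * (2 * p - p))) :=
      hp.mul ((hp1.const_mul 2).sub hp)
    have h3 := tendsto_nhds_unique h2 (hp1.congr h1)
    rwa [two_mul, add_sub_cancel_right] at h3
  have hfc : ∀ k, c * f k = f k * c := fun k => by
    have h : (1 - c ^ 2 ^ k) * c = c * (1 - c ^ 2 ^ k) := by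
      rw [sub_mul, mul_sub, one_mul, mul_one, ← pow_succ, ← pow_succ']
    refine (hu k).mul_left_cancel ?_
    rw [← mul_assoc, ← mul_assoc, h, mul_assoc, Ring.mul_inverse_cancel _ (hu k), one_mul, mul_one]
  have hpc : c * p = p * c :=
    tendsto_nhds_unique (hp.const_mul c) ((hp.mul_const c).congr fun k => (hfc k).symm)
  have hsub : ∀ k, 1 - f k = -(c ^ 2 ^ k * f k) := fun k => by
    have : (1 - c ^ 2 ^ k) * f k = 1 := Ring.mul_inverse_cancel _ (hu k)
    rw [sub_mul, one_mul] at this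
    rw [← this]
    abel
  have hlim : ∀ x : Ω, x = p → ∀ ε > 0, ∃ k, ‖x - f k‖ < ε := fun x hx ε hε => by
    obtain ⟨k, hk⟩ := (Metric.tendsto_atTop.1 hp ε hε)
    refine ⟨k, ?_⟩
    rw [hx, ← dist_eq_norm, dist_comm]
    exact hk k le_rfl
  have hzpow : ∀ z ∈ spectrum ℂ c, ∀ k : ℕ, ¬ IsUnit (z ^ 2 ^ k • (1 : Ω) - c ^ 2 ^ k) := by
    intro z hz k hun
    have := spectrum.pow_mem_pow c (2 ^ k) hz
    rw [spectrum.mem_iff, Algebra.algebraMap_eq_smul_one] at this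
    exact this hun
  refine ⟨p, hidem, ?_, ?_, ?_⟩
  · obtain ⟨k, hk⟩ := hlim p rfl 1 one_pos
    obtain ⟨n, hn⟩ : ∃ n, 2 ^ k = n + 1 := ⟨2 ^ k - 1, (Nat.sub_add_cancel Nat.one_le_two_pow).symm⟩
    have hy : 1 - f k = c * (-(c ^ n * f k)) := by
      rw [hsub, hn, pow_succ', mul_assoc, mul_neg]
    -- `1 - p` is a limit of multiples of `c`; a Neumann series makes it one
    have hv : IsUnit (1 - ((1 - p) - (1 - f k))) := by
      refine isUnit_one_sub_of_norm_lt_one ?_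
      rwa [sub_sub_sub_cancel_left, ← norm_neg, neg_sub]
    obtain ⟨v, hv⟩ := hv
    have hq : (1 - p) * (1 - p) = 1 - p := hidem.one_sub
    have hqc : (1 - p) * c = c * (1 - p) := by
      rw [sub_mul, mul_sub, one_mul, mul_one, hpc]
    have e : (1 - p) * v = c * ((1 - p) * (-(c ^ n * f k))) := by
      rw [hv, hy, mul_sub, mul_sub, mul_one, hq, sub_sub_cancel, ← mul_assoc, hqc, mul_assoc]
    refine ⟨(1 - p) * (-(c ^ n * f k)) * ↑v⁻¹, ?_⟩
    rw [← mul_assoc, ← e, mul_assoc, Units.mul_inv, mul_one]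
  · rintro ⟨z, hz, hz1⟩ hp0
    obtain ⟨k, hk⟩ := hlim 0 hp0.symm (1 / 2) (by norm_num)
    rw [zero_sub, norm_neg] at hk
    refine hzpow z hz k ?_
    have e : z ^ 2 ^ k • (1 : Ω) - c ^ 2 ^ k =
        (1 - c ^ 2 ^ k) * (1 - (1 - z ^ 2 ^ k) • f k) := by
      rw [mul_sub, mul_smul_comm, Ring.mul_inverse_cancel _ (hu k), sub_smul, one_smul, mul_one]
      abel
    rw [e]
    refine (hu k).mul (isUnit_one_sub_of_norm_lt_one ?_)
    have h1 : ‖1 - z ^ 2 ^ k‖ ≤ 2 := by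
      refine (norm_sub_le _ _).trans ?_
      rw [norm_one, norm_pow]
      linarith [pow_le_one₀ (n := 2 ^ k) (norm_nonneg z) hz1.le]
    rw [norm_smul]
    nlinarith [norm_nonneg (f k)]
  · rintro ⟨z, hz, hz1⟩ hp1
    obtain ⟨k, hk⟩ := hlim 1 hp1.symm (1 / 2) (by norm_num)
    refine hzpow z hz k ?_
    have hz0 : z ^ 2 ^ k ≠ 0 := pow_ne_zero _ (norm_pos_iff.1 (one_pos.trans hz1))
    have e : (z ^ 2 ^ k • (1 : Ω) - c ^ 2 ^ k) * f k =
        z ^ 2 ^ k • (1 - (1 - (z ^ 2 ^ k)⁻¹) • (1 - f k)) := by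
      have : c ^ 2 ^ k * f k = -(1 - f k) := by rw [hsub, neg_neg]
      rw [sub_mul, this, smul_mul_assoc, one_mul, smul_sub, smul_smul, mul_sub,
        mul_inv_cancel₀ hz0, mul_one, sub_smul, one_smul, smul_sub (z ^ 2 ^ k)]
      abel
    have h1 : ‖1 - (z ^ 2 ^ k)⁻¹‖ ≤ 2 := by
      refine (norm_sub_le _ _).trans ?_
      rw [norm_one, norm_inv, norm_pow]
      linarith [inv_le_one_of_one_le₀ (one_le_pow₀ (n := 2 ^ k) hz1.le)]
    have h2 : IsUnit ((z ^ 2 ^ k • (1 : Ω) - c ^ 2 ^ k) * f k) := by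
      rw [e]
      refine (isUnit_smul_iff_of_ne_zero hz0).2 (isUnit_one_sub_of_norm_lt_one ?_)
      rw [norm_smul]
      nlinarith [norm_nonneg (1 - f k)]
    obtain ⟨v, hv⟩ := hfu k
    rw [← hv] at h2
    exact (Units.isUnit_mul_units _ _).1 h2

/-- Some circle of radius less than `R` around `z₀` avoids the countable set `K`. -/
theorem exists_radius_of_countable {K : Set ℂ} (hK : K.Countable) (z₀ : ℂ) {R : ℝ} (hR : 0 < R) :
    ∃ r, 0 < r ∧ r < R ∧ ∀ z ∈ K, ‖z - z₀‖ ≠ r := by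
  obtain ⟨r, hr, hrK⟩ := ((hK.image fun z => ‖z - z₀‖).dense_compl ℝ).exists_mem_open isOpen_Ioo
    (nonempty_Ioo.2 hR)
  exact ⟨r, hrK.1, hrK.2, fun z hz h => hr ⟨z, hz, h⟩⟩

/-- Rescaling `exists_isIdempotentElem_of_unitCircle` to a circle avoiding a countable spectrum. -/
theorem exists_isIdempotentElem_of_countable {c : Ω} (hc : (spectrum ℂ c).Countable) (z₀ : ℂ)
    {z : ℂ} (hz : z ∈ spectrum ℂ c) (hne : z ≠ z₀) :
    ∃ p : Ω, IsIdempotentElem p ∧ (∃ y, 1 - p = (c - algebraMap ℂ Ω z₀) * y) ∧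
      (z₀ ∈ spectrum ℂ c → p ≠ 0) ∧ p ≠ 1 := by
  obtain ⟨r, hr, hrz, hrK⟩ := exists_radius_of_countable hc z₀ (norm_pos_iff.2 (sub_ne_zero.2 hne))
  have hr0 : (r : ℂ) ≠ 0 := Complex.ofReal_ne_zero.2 hr.ne'
  set d : Ω := (r : ℂ)⁻¹ • (c - algebraMap ℂ Ω z₀) with hd
  have hspec : ∀ w ∈ spectrum ℂ c, (w - z₀) / r ∈ spectrum ℂ d := by
    intro w hw
    rw [spectrum.mem_iff] at hw ⊢
    have e : algebraMap ℂ Ω ((w - z₀) / r) - d = (r : ℂ)⁻¹ • (algebraMap ℂ Ω w - c) := by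
      simp only [hd, Algebra.algebraMap_eq_smul_one, smul_sub, smul_smul, sub_div, sub_smul]
      rw [div_eq_inv_mul, div_eq_inv_mul]
      abel
    rwa [e, isUnit_smul_iff_of_ne_zero (inv_ne_zero hr0)]
  obtain ⟨p, hp, ⟨y, hy⟩, h0, h1⟩ := exists_isIdempotentElem_of_unitCircle (c := d) (by
    intro w hw
    have hw0 : w ≠ 0 := by
      rintro rfl
      simp at hw
    have e : 1 - w • d = (w * (r : ℂ)⁻¹) • (algebraMap ℂ Ω (r * w⁻¹ + z₀) - c) := by
      simp only [hd, Algebra.algebraMap_eq_smul_one, smul_sub, smul_smul, add_smul, smul_add,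
        mul_assoc]
      have : w * ((r : ℂ)⁻¹ * (r * w⁻¹)) = 1 := by field_simp
      rw [this, one_smul]
      abel
    rw [e, isUnit_smul_iff_of_ne_zero (mul_ne_zero hw0 (inv_ne_zero hr0))]
    by_contra hnu
    refine hrK _ (spectrum.mem_iff.2 hnu) ?_
    rw [add_sub_cancel_right, norm_mul, norm_inv, hw, inv_one, mul_one, Complex.norm_real,
      Real.norm_of_nonneg hr.le])
  refine ⟨p, hp, ⟨(r : ℂ)⁻¹ • y, ?_⟩, fun h => h0 ⟨_, hspec _ h, by simp⟩, h1 ⟨_, hspec _ hz, ?_⟩⟩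
  · rw [hy, hd, smul_mul_assoc, mul_smul_comm]
  · rw [norm_div, Complex.norm_real, Real.norm_of_nonneg hr.le]
    exact (one_lt_div hr).2 hrz

end Riesz

end ScatAlg

namespace ScatAlg

open Set Filter Topology Metric Bornology

/-! ### Binary trees of idempotents -/

section Tree

variable {Ω : Type*} [Ring Ω]

/-- A splitting procedure on a set `Q` of nonzero elements: below each `q` in `Q` there are two
orthogonal idempotents `child true q` and `child false q` in `Q`. Their sum need not be `q`. -/
structure IdempotentSplitting (Q : Set Ω) where
  child : Bool → Q → Q
  ne_zero : ∀ q : Q, (q : Ω) ≠ 0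
  child_mul : ∀ (b : Bool) (q : Q), (child b q : Ω) * q = child b q
  mul_child : ∀ (b : Bool) (q : Q), (q : Ω) * child b q = child b q
  child_mul_self : ∀ b q, (child b q : Ω) * child b q = child b q
  child_mul_child : ∀ b q, (child b q : Ω) * child (!b) q = 0

namespace IdempotentSplitting

variable {Q : Set Ω} (S : IdempotentSplitting Q)

/-- The sum of the left children `child true` over the `n`-th level of the tree with root `q`. -/
def level : ℕ → Q → Ω
  | 0, q => S.child true q
  | n + 1, q => level n (S.child true q) + level n (S.child false q)

/-- The idempotent reached after `m` steps from the root `q` along the branch `ξ`. -/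
def path : ℕ → (ℕ → Bool) → Q → Q
  | 0, _, q => q
  | m + 1, ξ, q => path m (fun n => ξ (n + 1)) (S.child (ξ 0) q)

theorem mul_level (n : ℕ) (q : Q) : (q : Ω) * S.level n q = S.level n q := by
  induction n generalizing q with
  | zero => exact S.mul_child true q
  | succ n ih =>
    have h : ∀ b, (q : Ω) * S.level n (S.child b q) = S.level n (S.child b q) := fun b => by
      rw [← ih (S.child b q), ← mul_assoc, S.mul_child]
    rw [level, mul_add, h, h]

theorem path_mul (m : ℕ) (ξ : ℕ → Bool) (q : Q) :
    (S.path m ξ q : Ω) * q = S.path m ξ q ∨ m = 0 := by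
  induction m generalizing ξ q with
  | zero => exact Or.inr rfl
  | succ m ih =>
    left
    simp only [path]
    rcases ih (fun n => ξ (n + 1)) (S.child (ξ 0) q) with h | rfl
    · rw [← h, mul_assoc, S.child_mul]
    · simp only [path]
      rw [S.child_mul]

theorem path_succ_mul_child (m : ℕ) (ξ : ℕ → Bool) (q : Q) :
    (S.path (m + 1) ξ q : Ω) * S.child (ξ 0) q = S.path (m + 1) ξ q := by
  rcases S.path_mul m (fun n => ξ (n + 1)) (S.child (ξ 0) q) with h | rfl
  · exact h
  · exact S.child_mul_self _ _

/-- The idempotent at the end of a branch selects from each level `n < m` the scalar `1` or `0`,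
according to the direction `ξ n` that the branch takes there. -/
theorem path_mul_level {n m : ℕ} (hnm : n < m) (ξ : ℕ → Bool) (q : Q) :
    (S.path m ξ q : Ω) * S.level n q = if ξ n then (S.path m ξ q : Ω) else 0 := by
  obtain ⟨m, rfl⟩ : ∃ k, m = k + 1 := ⟨m - 1, by omega⟩
  have hP := S.path_succ_mul_child m ξ q
  have hzero : ∀ x : Ω, (S.path (m + 1) ξ q : Ω) * (S.child (!(ξ 0)) q * x) = 0 := fun x => by
    rw [← hP, mul_assoc, ← mul_assoc (S.child (ξ 0) q : Ω), S.child_mul_child, zero_mul, mul_zero]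
  induction n generalizing m ξ q with
  | zero =>
    rw [level]
    cases h : ξ 0 with
    | true =>
      rw [h] at hP
      simpa using hP
    | false =>
      have := hzero (S.child true q)
      rw [h] at this
      simpa [S.child_mul_self] using this
  | succ n ih =>
    obtain ⟨k, rfl⟩ : ∃ k, m = k + 1 := ⟨m - 1, by omega⟩
    have hP' := S.path_succ_mul_child k (fun n => ξ (n + 1)) (S.child (ξ 0) q)
    have h1 := ih (fun n => ξ (n + 1)) (S.child (ξ 0) q) k (by omega) hP' (fun x => by
      rw [← hP', mul_assoc, ← mul_assoc (S.child _ (S.child (ξ 0) q) : Ω), S.child_mul_child,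
        zero_mul, mul_zero])
    have h2 : (S.path (k + 1 + 1) ξ q : Ω) * S.level n (S.child (!(ξ 0)) q) = 0 := by
      rw [← S.mul_level]
      exact hzero _
    change (S.path (k + 1 + 1) ξ q : Ω) * S.level n (S.child (ξ 0) q) =
      if ξ (n + 1) then (S.path (k + 1 + 1) ξ q : Ω) else 0 at h1
    rw [level, mul_add]
    cases h : ξ 0 with
    | true =>
      rw [h] at h1 h2
      rw [h1]
      change _ + (S.path (k + 1 + 1) ξ q : Ω) * S.level n (S.child (!true) q) = _
      rw [h2, add_zero]
    | false =>
      rw [h] at h1 h2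
      rw [h1]
      change (S.path (k + 1 + 1) ξ q : Ω) * S.level n (S.child (!false) q) + _ = _
      rw [h2, zero_add]

end IdempotentSplitting

end Tree

section Weights

/-- Positive weights decreasing by at least a factor `3` at each step, and small against a given
sequence. -/
theorem exists_weights (H : ℕ → ℝ) (hH : ∀ n, 0 ≤ H n) : ∃ ε : ℕ → ℝ, (∀ n, 0 < ε n) ∧
    (∀ n k, ε (n + k) ≤ ε n * (1 / 3) ^ k) ∧ Summable fun n => ε n * H n := by
  let δ : ℕ → ℝ := fun n => (3 * (1 + H n))⁻¹
  have hpos : ∀ n, 0 < 1 + H n := fun n => by linarith [hH n]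
  have hδ0 : ∀ n, 0 < δ n := fun n => inv_pos.2 (by linarith [hpos n])
  have hδ : ∀ n, δ n ≤ 1 / 3 := fun n => by
    rw [one_div]
    exact inv_anti₀ (by norm_num) (by linarith [hH n])
  have hδH : ∀ n, δ n * H n ≤ 1 := fun n => by
    simp only [δ]
    rw [inv_mul_le_iff₀ (by linarith [hpos n])]
    linarith [hH n]
  let ε : ℕ → ℝ := fun n => ∏ i ∈ Finset.range (n + 1), δ i
  have hε0 : ∀ n, 0 < ε n := fun n => Finset.prod_pos fun i _ => hδ0 i
  have hεs : ∀ n, ε (n + 1) = ε n * δ (n + 1) := fun n => Finset.prod_range_succ _ _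
  have hdec : ∀ n k, ε (n + k) ≤ ε n * (1 / 3) ^ k := by
    intro n k
    induction k with
    | zero => simp
    | succ k ih =>
      rw [← add_assoc, hεs, pow_succ, ← mul_assoc]
      exact mul_le_mul ih (hδ _) (hδ0 _).le (by have := hε0 n; positivity)
  refine ⟨ε, hε0, hdec, ?_⟩
  refine (summable_nat_add_iff 1).1 ?_
  refine Summable.of_nonneg_of_le (fun n => mul_nonneg (hε0 _).le (hH _)) (fun n => ?_)
    ((summable_geometric_of_lt_one (by norm_num) (by norm_num : (1 / 3 : ℝ) < 1)).mul_left (ε 0))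
  rw [hεs, mul_assoc]
  have := hdec 0 n
  rw [zero_add] at this
  calc ε n * (δ (n + 1) * H (n + 1)) ≤ ε n * 1 := by
        have := hε0 n
        gcongr
        exact hδH _
    _ ≤ _ := by rwa [mul_one]

theorem summable_ite_weights {ε : ℕ → ℝ} (hε : Summable ε) (h0 : ∀ n, 0 < ε n) (ξ : ℕ → Bool) :
    Summable fun n => if ξ n then ε n else 0 :=
  Summable.of_nonneg_of_le (fun n => by split_ifs <;> simp [(h0 n).le])
    (fun n => by split_ifs <;> simp [(h0 n).le]) hε

/-- As the weights decrease fast, distinct sets of indices have distinct weights. -/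
theorem injective_tsum_ite_weights {ε : ℕ → ℝ} (h0 : ∀ n, 0 < ε n)
    (hdec : ∀ n k, ε (n + k) ≤ ε n * (1 / 3) ^ k) (hε : Summable ε) :
    Function.Injective fun ξ : ℕ → Bool => ∑' n, if ξ n then ε n else 0 := by
  intro ξ η h
  by_contra hne
  have hex : ∃ n, ξ n ≠ η n := Function.ne_iff.1 hne
  classical
  -- at the first index where the sets differ, the weight exceeds the sum of all later ones
  let n := Nat.find hex
  have hn : ξ n ≠ η n := Nat.find_spec hex
  have hlt : ∀ k < n, ξ k = η k := fun k hk => not_not.1 (Nat.find_min hex hk)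
  let d : ℕ → ℝ := fun k => (if ξ k then ε k else 0) - if η k then ε k else 0
  have hs1 := summable_ite_weights hε h0 ξ
  have hs2 := summable_ite_weights hε h0 η
  have hd : Summable d := hs1.sub hs2
  have hsum : ∑' k, d k = 0 := by
    rw [hs1.tsum_sub hs2]
    exact sub_eq_zero.2 h
  have habs : ∀ k, |d k| ≤ ε k := fun k => by
    simp only [d]
    have := (h0 k).le
    split_ifs <;> simp [abs_of_nonneg this, this]
  have hdn : |d n| = ε n := by
    simp only [d]
    have := (h0 n).le
    cases h1 : ξ n <;> cases h2 : η n <;> simp_all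
  rw [← hd.sum_add_tsum_nat_add (n + 1), Finset.sum_range_succ,
    Finset.sum_eq_zero (fun k hk => by
      simp only [d]
      rw [hlt k (Finset.mem_range.1 hk), sub_self]), zero_add] at hsum
  have htail : ‖∑' k, d (k + (n + 1))‖ ≤ ε n * (1 / 3) * (1 - 1 / 3)⁻¹ := by
    refine tsum_of_norm_bounded ((hasSum_geometric_of_lt_one (by norm_num)
      (by norm_num : (1 / 3 : ℝ) < 1)).mul_left (ε n * (1 / 3))) fun k => ?_
    rw [Real.norm_eq_abs]
    refine (habs _).trans ((le_of_eq (by congr 1; ring)).trans ((hdec n (k + 1)).trans ?_))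
    rw [pow_succ]
    exact le_of_eq (by ring)
  have hlast : |d n| = ‖∑' k, d (k + (n + 1))‖ := by
    rw [eq_neg_of_add_eq_zero_left hsum, abs_neg, Real.norm_eq_abs]
  rw [← hlast, hdn] at htail
  have := h0 n
  norm_num at htail
  linarith

theorem not_countable_nat_bool : ¬ Countable (ℕ → Bool) := by
  intro h
  obtain ⟨f, hf⟩ := exists_surjective_nat (ℕ → Bool)
  obtain ⟨n, hn⟩ := hf fun n => !(f n n)
  have := congrFun hn n
  simp at this

end Weights

/-- A suitable sum of the levels of a binary tree of idempotents has uncountable spectrum: along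
each branch it is approximated by a scalar, and different branches give different scalars. -/
theorem IdempotentSplitting.exists_not_countable_spectrum {Ω : Type*} [NormedRing Ω]
    [NormedAlgebra ℂ Ω] [CompleteSpace Ω] {Q : Set Ω}
    (S : IdempotentSplitting Q) (q : Q) :
    ∃ x : Ω, (q : Ω) * x = x ∧ ¬ (spectrum ℂ x).Countable := by
  obtain ⟨ε, h0, hdec, hsum⟩ := exists_weights (fun n => ‖S.level n q‖) fun n => norm_nonneg _
  have hε : Summable ε := by
    refine Summable.of_nonneg_of_le (fun n => (h0 n).le) (fun n => ?_)
      ((summable_geometric_of_lt_one (by norm_num) (by norm_num : (1 / 3 : ℝ) < 1)).mul_left (ε 0))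
    simpa using hdec 0 n
  have hxs : Summable fun n => (ε n : ℂ) • S.level n q := by
    refine Summable.of_norm (hsum.congr fun n => ?_)
    rw [norm_smul, Complex.norm_real, Real.norm_of_nonneg (h0 n).le]
  let x : Ω := ∑' n, (ε n : ℂ) • S.level n q
  let v : (ℕ → Bool) → ℂ := fun ξ => ((∑' n, if ξ n then ε n else 0 : ℝ) : ℂ)
  have hv : Function.Injective v :=
    Complex.ofReal_injective.comp (injective_tsum_ite_weights h0 hdec hε)
  refine ⟨x, ?_, fun hc => not_countable_nat_bool ?_⟩
  · simp only [x]
    rw [← hxs.tsum_mul_left]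
    simp only [mul_smul_comm, S.mul_level]
  · rw [← countable_univ_iff]
    refine (hc.preimage_of_injOn hv.injOn).mono fun ξ _ => ?_
    change v ξ ∈ spectrum ℂ x
    rw [spectrum.mem_iff]
    rintro ⟨w, hw⟩
    let a : ℕ → Ω := fun n =>
      ((if ξ n then ε n else 0 : ℝ) : ℂ) • (1 : Ω) - (ε n : ℂ) • S.level n q
    have hs1 : HasSum (fun n => ((if ξ n then ε n else 0 : ℝ) : ℂ) • (1 : Ω)) (v ξ • 1) :=
      (Complex.hasSum_ofReal.2 (summable_ite_weights hε h0 ξ).hasSum).smul_const 1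
    have ha : HasSum a (w : Ω) := by
      rw [hw, Algebra.algebraMap_eq_smul_one]
      exact hs1.sub hxs.hasSum
    -- if `v ξ - x` were invertible, multiplying by idempotents far along the branch `ξ` would make
    -- it arbitrarily small
    have hmul : ∀ m, (S.path m ξ q : Ω) * w = S.path m ξ q * ∑' k, a (k + m) := fun m => by
      rw [← ha.tsum_eq, ← ha.summable.sum_add_tsum_nat_add m, mul_add, Finset.mul_sum,
        Finset.sum_eq_zero, zero_add]
      intro n hn
      simp only [a]
      rw [mul_sub, mul_smul_comm, mul_smul_comm, mul_one,
        S.path_mul_level (Finset.mem_range.1 hn)]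
      split_ifs <;> simp
    have hle : ∀ m, 1 ≤ ‖∑' k, a (k + m)‖ * ‖(↑w⁻¹ : Ω)‖ := fun m => by
      have hP : 0 < ‖(S.path m ξ q : Ω)‖ := norm_pos_iff.2 (S.ne_zero _)
      have e : (S.path m ξ q : Ω) = S.path m ξ q * ((∑' k, a (k + m)) * ↑w⁻¹) := by
        rw [← mul_assoc, ← hmul, mul_assoc, Units.mul_inv, mul_one]
      have h1 : ‖(S.path m ξ q : Ω)‖ ≤
          ‖(S.path m ξ q : Ω)‖ * (‖∑' k, a (k + m)‖ * ‖(↑w⁻¹ : Ω)‖) := by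
        conv_lhs => rw [e]
        refine (norm_mul_le _ _).trans ?_
        gcongr
        exact norm_mul_le _ _
      exact (le_mul_iff_one_le_right hP).1 h1
    have hlim : Tendsto (fun m => ‖∑' k, a (k + m)‖ * ‖(↑w⁻¹ : Ω)‖) atTop (𝓝 0) := by
      have := ((tendsto_sum_nat_add a).norm).mul_const ‖(↑w⁻¹ : Ω)‖
      rwa [norm_zero, zero_mul] at this
    exact absurd (ge_of_tendsto' hlim hle) (by norm_num)

section Minimal

theorem isUnit_one_sub_mul_swap {R : Type*} [Ring R] {x y : R} (h : IsUnit (1 - x * y)) :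
    IsUnit (1 - y * x) := by
  obtain ⟨v, h1, h2⟩ := isUnit_iff_exists.1 h
  refine isUnit_iff_exists.2 ⟨1 + y * v * x, ?_, ?_⟩
  · have : (1 - y * x) * (1 + y * v * x) = 1 - y * x + y * ((1 - x * y) * v) * x := by noncomm_ring
    rw [this, h1]
    noncomm_ring
  · have : (1 + y * v * x) * (1 - y * x) = 1 - y * x + y * (v * (1 - x * y)) * x := by noncomm_ring
    rw [this, h2]
    noncomm_ring

/-- A semisimple Banach algebra without nontrivial idempotents, all of whose elements have
countable spectrum, consists of scalars: every spectrum is a singleton. -/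
theorem exists_eq_algebraMap_of_countable {C : Type*} [NormedRing C] [NormedAlgebra ℂ C]
    [CompleteSpace C] [Nontrivial C] (hcount : ∀ x : C, (spectrum ℂ x).Countable)
    (hidem : ∀ p : C, IsIdempotentElem p → p = 0 ∨ p = 1)
    (hss : ∀ x : C, (∀ y, IsUnit (1 - x * y)) → x = 0) (x : C) :
    ∃ z, x = algebraMap ℂ C z := by
  have hsing : ∀ y : C, ∀ z ∈ spectrum ℂ y, ∀ w ∈ spectrum ℂ y, w = z := by
    intro y z hz w hw
    by_contra hne
    obtain ⟨p, hp, -, hp0, hp1⟩ := exists_isIdempotentElem_of_countable (hcount y) z hw hne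
    exact (hidem p hp).elim (hp0 hz) hp1
  obtain ⟨z, hz⟩ := spectrum.nonempty x
  refine ⟨z, sub_eq_zero.1 (hss _ fun y => ?_)⟩
  set w := x - algebraMap ℂ C z with hw
  have hwu : ¬ IsUnit w := by
    rw [spectrum.mem_iff, IsUnit.sub_iff] at hz
    exact hz
  by_contra hne
  -- otherwise `w y` has spectrum `{1}`, so that `w` has a right inverse
  have h1 : (1 : ℂ) ∈ spectrum ℂ (w * y) := by
    rwa [spectrum.mem_iff, map_one]
  have h0 : IsUnit (w * y) := by
    by_contra h
    exact zero_ne_one (hsing _ _ h1 0 (spectrum.zero_mem (R := ℂ) h))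
  obtain ⟨t, ht⟩ := h0
  have hright : w * (y * ↑t⁻¹) = 1 := by rw [← mul_assoc, ← ht, Units.mul_inv]
  have hid : IsIdempotentElem (y * ↑t⁻¹ * w) := by
    change y * ↑t⁻¹ * w * (y * ↑t⁻¹ * w) = _
    rw [mul_assoc _ w, ← mul_assoc w, hright, one_mul]
  rcases hidem _ hid with h | h
  · have : w = 0 := by
      rw [← one_mul w, ← hright, mul_assoc, h, mul_zero]
    rw [this, zero_mul] at hright
    exact zero_ne_one hright
  · exact hwu (isUnit_iff_exists.2 ⟨_, hright, h⟩)

variable {Ω : Type*} [NormedRing Ω] [NormedAlgebra ℂ Ω]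

/-- The defining property of the radical of the corner passes to the whole algebra. -/
theorem Corner.isUnit_one_sub_mul {e : Ω} (he : IsIdempotentElem e) {w : Corner he}
    (hw : ∀ y, IsUnit (1 - w * y)) (y : Ω) : IsUnit (1 - val he w * y) := by
  obtain ⟨y', hy'⟩ := exists_val_eq_mul_mul he y
  obtain ⟨v, h1, h2⟩ := isUnit_iff_exists.1 (hw y')
  have h1 := congrArg (val he) h1
  have h2 := congrArg (val he) h2
  simp only [val_mul, val_sub, val_one, hy'] at h1 h2
  have e1 : val he w * (e * y * e) = val he w * y * e := by
    rw [← mul_assoc, ← mul_assoc, val_mul_self]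
  rw [e1] at h1 h2
  have hev := mul_val he v
  have hve := val_mul_self he v
  have hee : e * e = e := he
  have hwe : e * (val he w * y * e) = val he w * y * e := by rw [← mul_assoc, ← mul_assoc, mul_val]
  have hwe' : (val he w * y * e) * e = val he w * y * e := by rw [mul_assoc, hee]
  have hunit : IsUnit (1 - val he w * y * e) := by
    generalize val he w * y * e = a at *
    refine isUnit_iff_exists.2 ⟨val he v + (1 - e), ?_, ?_⟩
    · have : (1 - a) * (val he v + (1 - e)) =
          (e - a) * val he v + (val he v - e * val he v) + (1 - e) - (a - a * e) := by noncomm_ring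
      rw [this, h1, hev, hwe']
      abel
    · have : (val he v + (1 - e)) * (1 - a) =
          val he v * (e - a) + (val he v - val he v * e) + (1 - e) - (a - e * a) := by noncomm_ring
      rw [this, h2, hve, hwe]
      abel
  have := isUnit_one_sub_mul_swap hunit
  rwa [← mul_assoc, mul_val] at this

/-- If all multiples of `b ≠ 0` have countable spectrum, then, modulo semisimplicity, `b Ω` contains
an idempotent `e` with `e Ω e = ℂ e`. Otherwise all nonzero idempotents in `b Ω` could be
split, giving a binary tree. -/
theorem exists_minimal_idempotent [CompleteSpace Ω] {b : Ω} (hb0 : b ≠ 0)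
    (hb : ∀ z, (spectrum ℂ (b * z)).Countable)
    (hrad : ∀ z, (∀ y, IsUnit (1 - b * z * y)) → b * z = 0) :
    ∃ e : Ω, IsIdempotentElem e ∧ e ≠ 0 ∧ (∃ z, e = b * z) ∧ ∀ x, ∃ c : ℂ, e * x * e = c • e := by
  by_contra! hmin
  let Q : Set Ω := {e | IsIdempotentElem e ∧ e ≠ 0 ∧ ∃ z, e = b * z}
  have hsplit : ∀ e : Q, ∃ f : Q, (f : Ω) * e = f ∧ (e : Ω) * f = f ∧ (e : Ω) - f ∈ Q := by
    rintro ⟨e, he, he0, z, hz⟩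
    obtain ⟨x, hx⟩ := hmin e he he0 ⟨z, hz⟩
    have := Corner.nontrivial he he0
    have hmul : ∀ w : Corner he, Corner.val he w = b * (z * Corner.val he w) := fun w => by
      rw [← mul_assoc, ← hz, Corner.mul_val]
    have hex : ∃ p : Corner he, IsIdempotentElem p ∧ p ≠ 0 ∧ p ≠ 1 := by
      by_contra! hid
      obtain ⟨w, hw⟩ := Corner.exists_val_eq_mul_mul he x
      obtain ⟨c, hc⟩ := exists_eq_algebraMap_of_countable (C := Corner he)
        (fun w => (by rw [hmul w]; exact hb _ :
          (spectrum ℂ (Corner.val he w)).Countable).mono (Corner.spectrum_subset he w))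
        (fun p hp => or_iff_not_imp_left.2 (hid p hp))
        (fun w hw => Corner.val_injective he (by
          rw [Corner.val_zero, hmul w]
          refine hrad _ fun y => ?_
          rw [← hmul w]
          exact Corner.isUnit_one_sub_mul he hw y)) w
      refine hx c ?_
      rw [← hw, hc, Corner.val_algebraMap]
    obtain ⟨p, hp, hp0, hp1⟩ := hex
    set f := Corner.val he p with hf
    have hff : f * f = f := congrArg (Corner.val he) hp
    have hfe : f * e = f := Corner.val_mul_self he p
    have hef : e * f = f := Corner.mul_val he p
    refine ⟨⟨f, hff, fun h => hp0 (Corner.val_injective he h), _, hmul p⟩, hfe, hef, ?_, ?_,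
      z - z * f, ?_⟩
    · change (e - f) * (e - f) = e - f
      rw [mul_sub, sub_mul, sub_mul, he, hfe, hef, hff, sub_self, sub_zero]
    · exact fun h => hp1 (Corner.val_injective he (sub_eq_zero.1 h).symm)
    · change e - f = b * (z - z * f)
      rw [mul_sub, ← hz, hf, ← hmul p]
  choose F hF1 hF2 hF3 using hsplit
  let S : IdempotentSplitting Q :=
    { child := fun b q => if b then F q else ⟨q - F q, hF3 q⟩
      ne_zero := fun q => q.2.2.1
      child_mul := fun b q => by
        have hq : (q : Ω) * q = q := q.2.1
        cases b <;> simp [sub_mul, hF1, hq]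
      mul_child := fun b q => by
        have hq : (q : Ω) * q = q := q.2.1
        cases b <;> simp [mul_sub, hF2, hq]
      child_mul_self := fun b q => by
        have hq : (q : Ω) * q = q := q.2.1
        have hf : (F q : Ω) * F q = F q := (F q).2.1
        cases b <;> simp [mul_sub, sub_mul, hF1, hF2, hq, hf]
      child_mul_child := fun b q => by
        have hf : (F q : Ω) * F q = F q := (F q).2.1
        cases b <;> simp [mul_sub, sub_mul, hF1, hF2, hf] }
  -- the first idempotent comes from a multiple of `b` with nonzero spectrum
  obtain ⟨y, hy⟩ : ∃ y, ¬ IsUnit (1 - b * y) := by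
    by_contra! h
    refine hb0 ?_
    have := hrad 1
    rw [mul_one] at this
    exact this h
  have h1 : (1 : ℂ) ∈ spectrum ℂ (b * y) := by rwa [spectrum.mem_iff, map_one]
  obtain ⟨p, hp, ⟨t, ht⟩, -, hp1⟩ := exists_isIdempotentElem_of_countable (hb y) 0 h1 one_ne_zero
  rw [map_zero, sub_zero, mul_assoc] at ht
  let q : Q := ⟨1 - p, hp.one_sub, sub_ne_zero.2 hp1.symm, _, ht⟩
  obtain ⟨x, hx, hxc⟩ := S.exists_not_countable_spectrum q
  refine hxc ?_
  rw [← hx]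
  change (spectrum ℂ ((1 - p) * x)).Countable
  rw [ht, mul_assoc]
  exact hb _

end Minimal

end ScatAlg

namespace ScatAlg

open Set Filter Topology Metric Bornology

/-! ### Semisimple quotients of Banach algebras -/

section Jacobson

variable {R S : Type*} [Ring R] [Ring S]

theorem mem_ringJacobson_iff {x : R} : x ∈ Ring.jacobson R ↔ ∀ y, IsUnit (1 - x * y) := by
  rw [← Ideal.jacobson_bot, Ideal.mem_jacobson_iff]
  have hl : (∀ y, ∃ z, z * y * x + z - 1 ∈ (⊥ : Ideal R)) ↔ ∀ y, ∃ z, z * (1 - y * x) = 1 := by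
    constructor
    · intro h y
      obtain ⟨z, hz⟩ := h (-y)
      refine ⟨z, sub_eq_zero.1 ?_⟩
      rw [Ideal.mem_bot] at hz
      rw [← hz]
      noncomm_ring
    · intro h y
      obtain ⟨z, hz⟩ := h (-y)
      refine ⟨z, ?_⟩
      rw [Ideal.mem_bot, ← sub_eq_zero.2 hz]
      noncomm_ring
  rw [hl]
  constructor
  · intro h y
    refine isUnit_one_sub_mul_swap ?_
    obtain ⟨z, hz⟩ := h y
    -- the left inverse `z` of `1 - y x` is itself of the form `1 - (-z y) x`
    obtain ⟨w, hw⟩ := h (-(z * y))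
    have hz' : 1 - -(z * y) * x = z := by
      rw [mul_sub, mul_one, sub_eq_iff_eq_add] at hz
      rw [neg_mul, sub_neg_eq_add, mul_assoc, ← hz]
    rw [hz'] at hw
    have hwz : w = 1 - y * x := left_inv_eq_right_inv hw hz
    exact isUnit_iff_exists.2 ⟨z, by rw [← hwz, hw], hz⟩
  · intro h y
    obtain ⟨z, -, hz⟩ := isUnit_iff_exists.1 (isUnit_one_sub_mul_swap (h y))
    exact ⟨z, hz⟩

theorem map_mem_ringJacobson {f : R →+* S} (hf : Function.Surjective f) {x : R}
    (hx : ∀ y, IsUnit (f (1 - x * y))) : f x ∈ Ring.jacobson S := by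
  refine mem_ringJacobson_iff.2 fun y => ?_
  obtain ⟨y, rfl⟩ := hf y
  have := hx y
  rwa [map_sub, map_one, map_mul] at this

/-- Units lift modulo the Jacobson radical. -/
theorem isUnit_of_map_of_ker_le_jacobson {f : R →+* S} (hf : Function.Surjective f)
    (hker : ∀ x, f x = 0 → x ∈ Ring.jacobson R) {x : R} (hx : IsUnit (f x)) : IsUnit x := by
  obtain ⟨v, h1, h2⟩ := isUnit_iff_exists.1 hx
  obtain ⟨y, rfl⟩ := hf v
  have key : ∀ t, f t = 1 → IsUnit t := fun t ht => by
    have h := mem_ringJacobson_iff.1 (hker (1 - t) (by rw [map_sub, map_one, ht, sub_self])) 1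
    rwa [mul_one, sub_sub_cancel] at h
  obtain ⟨a, ha⟩ := key (x * y) (by rw [map_mul, h1])
  obtain ⟨b, hb⟩ := key (y * x) (by rw [map_mul, h2])
  have hr : x * (y * ↑a⁻¹) = 1 := by rw [← mul_assoc, ← ha, Units.mul_inv]
  have hl : ↑b⁻¹ * y * x = 1 := by rw [mul_assoc, ← hb, Units.inv_mul]
  refine isUnit_iff_exists.2 ⟨y * ↑a⁻¹, hr, ?_⟩
  rw [← left_inv_eq_right_inv hl hr, hl]

end Jacobson

section BanachQuotient

variable {Ω : Type*} [NormedRing Ω] [NormedAlgebra ℂ Ω] [CompleteSpace Ω]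

/-- A quotient of a Banach algebra by a closed ideal is a Banach algebra. The ideal is given as the
kernel of a surjection `ψ`, and the norm is transported to the target. -/
theorem exists_normedRing_of_isClosed {E : Type u} [Ring E] [Algebra ℂ E] (ψ : Ω →ₐ[ℂ] E)
    (hψ : Function.Surjective ψ) (hcl : IsClosed {x | ψ x = 0}) :
    ∃ (F : Type u) (_ : NormedRing F) (_ : NormedAlgebra ℂ F) (_ : CompleteSpace F),
      Nonempty (E ≃ₐ[ℂ] F) := by
  let K : Submodule ℂ Ω := LinearMap.ker ψ.toLinearMap
  have hK : IsClosed (K : Set Ω) := hcl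
  let Φ : E ≃ₗ[ℂ] Ω ⧸ K := (ψ.toLinearMap.quotKerEquivOfSurjective hψ).symm
  have hΦ : ∀ x : Ω, Φ (ψ x) = Submodule.Quotient.mk x := fun x => by
    rw [LinearEquiv.symm_apply_eq]
    rfl
  let ng : NormedAddCommGroup E := NormedAddCommGroup.induced E (Ω ⧸ K) Φ Φ.injective
  have hnorm : ∀ x : E, ‖x‖ = ‖Φ x‖ := fun x => rfl
  have hlift : ∀ x : E, ∀ ε > 0, ∃ a : Ω, ψ a = x ∧ ‖a‖ < ‖x‖ + ε := fun x ε hε => by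
    obtain ⟨a, ha, ha'⟩ := Submodule.Quotient.norm_mk_lt (Φ x) hε
    refine ⟨a, Φ.injective ?_, ha'⟩
    rw [hΦ, ha]
  have hle : ∀ a : Ω, ‖ψ a‖ ≤ ‖a‖ := fun a => by
    rw [hnorm, hΦ]
    exact Submodule.Quotient.norm_mk_le K a
  let nr : NormedRing E :=
    { (inferInstance : Ring E), ng with
      norm_mul_le := fun x y => by
        have hlim : Tendsto (fun ε : ℝ => (‖x‖ + ε) * (‖y‖ + ε)) (𝓝[>] 0) (𝓝 (‖x‖ * ‖y‖)) := by
          have : Continuous fun ε : ℝ => (‖x‖ + ε) * (‖y‖ + ε) := by fun_prop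
          have := this.tendsto 0
          simp only [add_zero] at this
          exact this.mono_left nhdsWithin_le_nhds
        refine ge_of_tendsto hlim ?_
        filter_upwards [self_mem_nhdsWithin] with ε hε
        obtain ⟨a, rfl, ha⟩ := hlift x ε hε
        obtain ⟨b, rfl, hb⟩ := hlift y ε hε
        rw [← map_mul]
        refine (hle _).trans ((norm_mul_le _ _).trans ?_)
        exact mul_le_mul ha.le hb.le (norm_nonneg _) ((norm_nonneg a).trans ha.le) }
  let na : NormedAlgebra ℂ E :=
    { (inferInstance : Algebra ℂ E) with
      norm_smul_le := fun z x => by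
        rw [hnorm, hnorm, map_smul]
        exact norm_smul_le z (Φ x) }
  refine ⟨E, nr, na, ?_, ⟨AlgEquiv.refl⟩⟩
  have hiso : Isometry Φ := AddMonoidHomClass.isometry_of_norm Φ fun x => rfl
  exact (completeSpace_congr (e := Φ.toEquiv) hiso.isUniformEmbedding).2 inferInstance

/-- The kernel of a map onto a semisimple algebra is closed, because invertibility is an open
condition: the image of its closure lies in the Jacobson radical. -/
theorem exists_normedRing_of_jacobson_eq_bot {E : Type u} [Ring E] [Algebra ℂ E] (ψ : Ω →ₐ[ℂ] E)
    (hψ : Function.Surjective ψ) (hE : Ring.jacobson E = ⊥) :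
    ∃ (F : Type u) (_ : NormedRing F) (_ : NormedAlgebra ℂ F) (_ : CompleteSpace F),
      Nonempty (E ≃ₐ[ℂ] F) := by
  refine exists_normedRing_of_isClosed ψ hψ (isClosed_of_closure_subset fun x hx => ?_)
  have hmem : ψ x ∈ Ring.jacobson E := by
    refine map_mem_ringJacobson (f := ψ.toRingHom) hψ fun y => ?_
    have hcont : Continuous fun k : Ω => 1 - (x - k) * y := by fun_prop
    have hnhds : {k : Ω | IsUnit (1 - (x - k) * y)} ∈ 𝓝 x :=
      (Units.isOpen.preimage hcont).mem_nhds (by simp)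
    obtain ⟨k, hk, hk0⟩ := mem_closure_iff_nhds.1 hx _ hnhds
    have hk0 : ψ k = 0 := hk0
    have : ψ (1 - (x - k) * y) = ψ (1 - x * y) := by
      simp only [map_sub, map_mul, map_one, hk0, sub_zero]
    change IsUnit (ψ (1 - x * y))
    rw [← this]
    exact IsUnit.map ψ hk
  rw [hE] at hmem
  exact hmem

end BanachQuotient

section Unitization

variable {A B : Type*} [NonUnitalRing A] [Module ℂ A] [IsScalarTower ℂ A A] [SMulCommClass ℂ A A]
  [NonUnitalRing B] [Module ℂ B] [IsScalarTower ℂ B B] [SMulCommClass ℂ B B]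

/-- The extension of a homomorphism to unitizations. -/
noncomputable def unitizationMap (φ : A →ₙₐ[ℂ] B) : Unitization ℂ A →ₐ[ℂ] Unitization ℂ B :=
  Unitization.lift ((Unitization.inrNonUnitalAlgHom ℂ B).comp φ)

theorem unitizationMap_inr (φ : A →ₙₐ[ℂ] B) (a : A) :
    unitizationMap φ (a : Unitization ℂ A) = (φ a : Unitization ℂ B) := by
  simp [unitizationMap]

theorem unitization_eq_algebraMap_add (x : Unitization ℂ A) :
    x = algebraMap ℂ _ x.fst + (x.snd : Unitization ℂ A) := by
  ext <;> simp [Unitization.algebraMap_eq_inl]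

theorem unitizationMap_apply (φ : A →ₙₐ[ℂ] B) (x : Unitization ℂ A) :
    unitizationMap φ x = algebraMap ℂ _ x.fst + (φ x.snd : Unitization ℂ B) := by
  conv_lhs => rw [unitization_eq_algebraMap_add x]
  rw [map_add, AlgHom.commutes, unitizationMap_inr]

theorem unitizationMap_surjective {φ : A →ₙₐ[ℂ] B} (hφ : Function.Surjective φ) :
    Function.Surjective (unitizationMap φ) := by
  intro y
  obtain ⟨a, ha⟩ := hφ y.snd
  refine ⟨algebraMap ℂ _ y.fst + (a : Unitization ℂ A), ?_⟩
  rw [map_add, AlgHom.commutes, unitizationMap_inr, ha, ← unitization_eq_algebraMap_add]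

theorem unitizationMap_eq_zero {φ : A →ₙₐ[ℂ] B} {x : Unitization ℂ A}
    (hx : unitizationMap φ x = 0) : ∃ a, φ a = 0 ∧ x = (a : Unitization ℂ A) := by
  rw [unitizationMap_apply] at hx
  have h1 : x.fst = 0 := by
    simpa [Unitization.algebraMap_eq_inl] using congrArg (fun y : Unitization ℂ B => y.fst) hx
  have h2 : φ x.snd = 0 := by
    simpa [Unitization.algebraMap_eq_inl] using congrArg (fun y : Unitization ℂ B => y.snd) hx
  refine ⟨x.snd, h2, ?_⟩
  conv_lhs => rw [unitization_eq_algebraMap_add x, h1, map_zero, zero_add]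

theorem mem_jacobsonRadical {a : A} :
    a ∈ jacobsonRadical A ↔ (a : Unitization ℂ A) ∈ Ring.jacobson (Unitization ℂ A) := Iff.rfl

theorem jacobson_unitization_eq_bot (hA : ∀ a ∈ jacobsonRadical A, a = 0) :
    Ring.jacobson (Unitization ℂ A) = ⊥ := by
  refine (Submodule.eq_bot_iff _).2 fun x hx => ?_
  have h0 : x.fst = 0 := by
    by_contra hne
    have := mem_ringJacobson_iff.1 hx (algebraMap ℂ _ (x.fst)⁻¹)
    have h1 := this.map (Unitization.fstHom ℂ A)
    rw [map_sub, map_one, map_mul, AlgHom.commutes, Algebra.algebraMap_self_apply,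
      Unitization.fstHom_apply, mul_inv_cancel₀ hne, sub_self] at h1
    exact not_isUnit_zero h1
  have hxe : x = (x.snd : Unitization ℂ A) := by
    conv_lhs => rw [unitization_eq_algebraMap_add x, h0, map_zero, zero_add]
  rw [hxe, hA x.snd (mem_jacobsonRadical.2 (by rwa [← hxe])), Unitization.inr_zero]

namespace AlgIdeal

/-- The quotient map as a homomorphism of algebras. -/
def quotHom (I : AlgIdeal A) : A →ₙₐ[ℂ] I.Quot :=
  { I.quotMap with
    map_zero' := map_zero I.quotMap
    map_mul' := I.quotMap_mul }

omit [IsScalarTower ℂ A A] [SMulCommClass ℂ A A] in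
theorem quotMap_eq_zero_iff (I : AlgIdeal A) {a : A} : I.quotMap a = 0 ↔ a ∈ I := by
  rw [← map_zero I.quotMap, quotMap_eq_iff, sub_zero]

omit [IsScalarTower ℂ A A] [SMulCommClass ℂ A A] in
theorem mem_preimage {I : AlgIdeal A} {K : AlgIdeal I.Quot} {a : A} :
    a ∈ I.preimage K ↔ I.quotMap a ∈ K := Iff.rfl

theorem mem_socle_iff {a : A} :
    a ∈ socle A ↔ a ∈ sSup {L : Submodule ℂ A | IsMinimalLeftIdeal L} := Iff.rfl

end AlgIdeal

theorem isUnit_of_isUnit_map_quotHom_jacobsonRadical {x : Unitization ℂ A}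
    (hx : IsUnit (unitizationMap (jacobsonRadical A).quotHom x)) : IsUnit x := by
  refine isUnit_of_map_of_ker_le_jacobson
    (f := (unitizationMap (jacobsonRadical A).quotHom : Unitization ℂ A →ₐ[ℂ] _).toRingHom)
    (unitizationMap_surjective (jacobsonRadical A).quotMap_surjective) (fun y hy => ?_) hx
  obtain ⟨a, ha, rfl⟩ := unitizationMap_eq_zero hy
  exact (AlgIdeal.quotMap_eq_zero_iff _).1 ha

/-- The quotient by the Jacobson radical is semisimple. -/
theorem eq_zero_of_mem_jacobsonRadical_quot (d : (jacobsonRadical A).Quot)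
    (hd : d ∈ jacobsonRadical (jacobsonRadical A).Quot) : d = 0 := by
  obtain ⟨a, rfl⟩ := (jacobsonRadical A).quotMap_surjective d
  rw [AlgIdeal.quotMap_eq_zero_iff, mem_jacobsonRadical, mem_ringJacobson_iff]
  rw [mem_jacobsonRadical, mem_ringJacobson_iff] at hd
  intro y
  refine isUnit_of_isUnit_map_quotHom_jacobsonRadical ?_
  rw [map_sub, map_one, map_mul, unitizationMap_inr]
  exact hd _

end Unitization

section Socle

variable {D : Type*} [NonUnitalRing D] [Module ℂ D] [IsScalarTower ℂ D D] [SMulCommClass ℂ D D]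

theorem exists_inr_eq_mul (x : Unitization ℂ D) (d : D) :
    ∃ d' : D, (d' : Unitization ℂ D) = x * d ∧
      ∀ L : Submodule ℂ D, IsLeftIdeal L → d ∈ L → d' ∈ L := by
  refine ⟨x.fst • d + x.snd * d, ?_, fun L hL hd => L.add_mem (L.smul_mem _ hd) (hL _ _ hd)⟩
  conv_rhs => rw [unitization_eq_algebraMap_add x]
  rw [add_mul, Unitization.inr_add, Unitization.inr_mul, Unitization.inr_smul, Algebra.smul_def]

theorem exists_inr_eq_mul' (d : D) (x : Unitization ℂ D) :
    ∃ d' : D, (d' : Unitization ℂ D) = d * x := by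
  refine ⟨x.fst • d + d * x.snd, ?_⟩
  conv_rhs => rw [unitization_eq_algebraMap_add x]
  rw [mul_add, Unitization.inr_add, Unitization.inr_mul, Unitization.inr_smul, Algebra.smul_def,
    Algebra.commutes]

variable {E : Type*}

/-- Minimal left ideals of `D` are minimal left ideals of the unitization. -/
theorem exists_isAtom_of_isMinimalLeftIdeal [Ring E] [Algebra ℂ E] (e : Unitization ℂ D ≃ₐ[ℂ] E)
    {L : Submodule ℂ D} (hL : IsMinimalLeftIdeal L) :
    ∃ L' : Ideal E, IsAtom L' ∧ ∀ d ∈ L, e (d : Unitization ℂ D) ∈ L' := by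
  let L' : Ideal E :=
    { carrier := {x | ∃ d ∈ L, e (d : Unitization ℂ D) = x}
      add_mem' := by
        rintro _ _ ⟨a, ha, rfl⟩ ⟨b, hb, rfl⟩
        exact ⟨a + b, L.add_mem ha hb, by rw [Unitization.inr_add, map_add]⟩
      zero_mem' := ⟨0, L.zero_mem, by rw [Unitization.inr_zero, map_zero]⟩
      smul_mem' := by
        rintro x _ ⟨a, ha, rfl⟩
        obtain ⟨d, hd, hdL⟩ := exists_inr_eq_mul (e.symm x) a
        exact ⟨d, hdL L hL.1.1 ha, by rw [hd, map_mul, e.apply_symm_apply, smul_eq_mul]⟩ }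
  have hinj : ∀ d : D, e (d : Unitization ℂ D) = 0 → d = 0 := fun d hd =>
    Unitization.inr_injective (R := ℂ) (by
      rw [Unitization.inr_zero]
      exact e.injective (by rw [hd, map_zero]))
  refine ⟨L', ⟨fun h => hL.1.2 ((Submodule.eq_bot_iff L).2 fun d hd => hinj d ?_), fun K hK => ?_⟩,
    fun d hd => ⟨d, hd, rfl⟩⟩
  · have : e (d : Unitization ℂ D) ∈ L' := ⟨d, hd, rfl⟩
    rwa [h, Ideal.mem_bot] at this
  · by_contra hK0
    let K₀ : Submodule ℂ D :=
      { carrier := {d | e (d : Unitization ℂ D) ∈ K}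
        add_mem' := fun {a b} ha hb => by
          simp only [mem_ofPred_eq, Unitization.inr_add, map_add] at *
          exact K.add_mem ha hb
        zero_mem' := by simp
        smul_mem' := fun z a ha => by
          simp only [mem_ofPred_eq, Unitization.inr_smul, map_smul] at *
          rw [Algebra.smul_def]
          exact K.mul_mem_left _ ha }
    have hK₀ : IsLeftIdeal K₀ := fun a x hx => by
      change e ((a * x : D) : Unitization ℂ D) ∈ K
      rw [Unitization.inr_mul, map_mul]
      exact K.mul_mem_left _ hx
    have hK₀L : K₀ ≤ L := fun d hd => by
      obtain ⟨d', hd', h⟩ := hK.le hd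
      have := Unitization.inr_injective (R := ℂ) (e.injective h)
      rwa [← this]
    have hne : K₀ ≠ ⊥ := fun h => hK0 ((Submodule.eq_bot_iff K).2 fun x hx => by
      obtain ⟨d, -, rfl⟩ := hK.le hx
      have : d ∈ K₀ := hx
      rw [h, Submodule.mem_bot] at this
      rw [this, Unitization.inr_zero, map_zero])
    refine hK.not_ge ?_
    rintro _ ⟨d, hd, rfl⟩
    exact hL.2 ⟨hK₀, hne⟩ hK₀L hd

variable [NormedRing E] [NormedAlgebra ℂ E] [CompleteSpace E]

theorem isInessential_of_mem_socle (e : Unitization ℂ D ≃ₐ[ℂ] E) {d : D} (hd : d ∈ socle D) :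
    IsInessential (e (d : Unitization ℂ D)) := by
  rw [AlgIdeal.mem_socle_iff, sSup_eq_iSup] at hd
  refine Submodule.iSup_induction' (p := fun L : Submodule ℂ D =>
    ⨆ (_ : L ∈ {L : Submodule ℂ D | IsMinimalLeftIdeal L}), L)
    (motive := fun d _ => IsInessential (e (d : Unitization ℂ D))) ?_ ?_ ?_ hd
  · intro L x hx
    by_cases hL : IsMinimalLeftIdeal L
    · obtain ⟨L', hL', hLe⟩ := exists_isAtom_of_isMinimalLeftIdeal e hL
      rw [iSup_pos (show L ∈ {L : Submodule ℂ D | IsMinimalLeftIdeal L} from hL)] at hx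
      exact isInessential_of_isAtom hL' (hLe x hx)
    · rw [iSup_neg (show L ∉ {L : Submodule ℂ D | IsMinimalLeftIdeal L} from hL),
        Submodule.mem_bot] at hx
      rw [hx, Unitization.inr_zero, map_zero]
      exact IsInessential.zero
  · rw [Unitization.inr_zero, map_zero]
    exact IsInessential.zero
  · intro x y _ _ hx hy
    rw [Unitization.inr_add, map_add]
    exact hx.add hy

/-- The Fredholm alternative for the socle. -/
theorem countable_quasispectrum_inter_outerComponent_socle (e : Unitization ℂ D ≃ₐ[ℂ] E) (d : D) :
    (quasispectrum ℂ d ∩ outerComponent (quasispectrum ℂ ((socle D).quotMap d))).Countable := by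
  let ρ : E →ₐ[ℂ] Unitization ℂ (socle D).Quot :=
    (unitizationMap (socle D).quotHom).comp e.symm.toAlgHom
  have hρ : Function.Surjective ρ :=
    (unitizationMap_surjective (socle D).quotMap_surjective).comp e.symm.surjective
  have := countable_spectrum_inter_outerComponent ρ hρ (fun s hs => by
    obtain ⟨a, ha, has⟩ := unitizationMap_eq_zero (show unitizationMap (socle D).quotHom
      (e.symm s) = 0 from hs)
    rw [← e.apply_symm_apply s, has]
    exact isInessential_of_mem_socle e ((AlgIdeal.quotMap_eq_zero_iff _).1 ha))
    (e (d : Unitization ℂ D))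
  have h1 : ρ (e (d : Unitization ℂ D)) = ((socle D).quotMap d : Unitization ℂ (socle D).Quot) := by
    change unitizationMap (socle D).quotHom (e.symm (e (d : Unitization ℂ D))) = _
    rw [e.symm_apply_apply, unitizationMap_inr]
    rfl
  rwa [h1, AlgEquiv.spectrum_eq, ← Unitization.quasispectrum_eq_spectrum_inr,
    ← Unitization.quasispectrum_eq_spectrum_inr] at this

theorem countable_of_image_sq_countable {S T : Set ℂ} (hT : T.Countable)
    (h : ∀ z ∈ S, z ^ 2 ∈ T) : S.Countable := by
  refine (hT.biUnion (t := fun w _ => {z : ℂ | z ^ 2 = w}) fun w _ => ?_).mono fun z hz =>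
    mem_iUnion₂.2 ⟨z ^ 2, h z hz, rfl⟩
  rcases {z : ℂ | z ^ 2 = w}.eq_empty_or_nonempty with h0 | ⟨z₀, hz₀⟩
  · rw [h0]
    exact countable_empty
  · refine ((finite_singleton (-z₀)).insert z₀).countable.mono fun z hz => ?_
    have : z ^ 2 = z₀ ^ 2 := by rw [show z ^ 2 = w from hz, show z₀ ^ 2 = w from hz₀]
    exact sq_eq_sq_iff_eq_or_eq_neg.1 this

/-- In a semisimple Banach algebra with zero socle, only zero generates a right ideal of elements
with countable spectrum. -/
theorem eq_zero_of_countable_of_socle_eq_zero (e : Unitization ℂ D ≃ₐ[ℂ] E)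
    (hrad : ∀ a ∈ jacobsonRadical D, a = 0) (hsoc : ∀ a ∈ socle D, a = 0) {d : D}
    (hd : ∀ x, (quasispectrum ℂ (d * x)).Countable) : d = 0 := by
  by_contra hd0
  have hinj : ∀ d : D, e (d : Unitization ℂ D) = 0 → d = 0 := fun d hd =>
    Unitization.inr_injective (R := ℂ) (by
      rw [Unitization.inr_zero]
      exact e.injective (by rw [hd, map_zero]))
  have hss : ∀ x : E, (∀ y, IsUnit (1 - x * y)) → x = 0 := fun x hx => by
    have h : e.symm x ∈ Ring.jacobson (Unitization ℂ D) :=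
      map_mem_ringJacobson (f := e.symm.toAlgHom.toRingHom) e.symm.surjective fun y =>
        (hx y).map e.symm
    rw [jacobson_unitization_eq_bot hrad, Ideal.mem_bot] at h
    rw [← e.apply_symm_apply x, h, map_zero]
  have hcount : ∀ z : E, (spectrum ℂ (e (d : Unitization ℂ D) * z)).Countable := fun z => by
    -- `z` need not come from `D`, but `(d z)² = d (z d z)` with `z d z` in `D`
    obtain ⟨t, ht, -⟩ := exists_inr_eq_mul (e.symm z) d
    obtain ⟨x, hx⟩ := exists_inr_eq_mul' t (e.symm z)
    have hsq : (e (d : Unitization ℂ D) * z) ^ 2 = e ((d * x : D) : Unitization ℂ D) := by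
      rw [Unitization.inr_mul, hx, ht, map_mul, map_mul, map_mul, e.apply_symm_apply, sq]
      noncomm_ring
    refine countable_of_image_sq_countable (hd x) fun w hw => ?_
    rw [Unitization.quasispectrum_eq_spectrum_inr, ← AlgEquiv.spectrum_eq e, ← hsq]
    exact spectrum.pow_mem_pow _ 2 hw
  obtain ⟨p, hp, hp0, ⟨z, hz⟩, hmin⟩ := exists_minimal_idempotent (fun h => hd0 (hinj d h)) hcount
    fun z => hss _
  obtain ⟨t, ht⟩ := exists_inr_eq_mul' d (e.symm z)
  have hpt : p = e (t : Unitization ℂ D) := by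
    rw [ht, map_mul, e.apply_symm_apply, hz]
  have hmap : ∀ a b : D, e ((a * b : D) : Unitization ℂ D) =
      e (a : Unitization ℂ D) * e (b : Unitization ℂ D) := fun a b => by
    rw [Unitization.inr_mul, map_mul]
  have hinj' : ∀ a b : D, e (a : Unitization ℂ D) = e (b : Unitization ℂ D) → a = b :=
    fun a b h => Unitization.inr_injective (R := ℂ) (e.injective h)
  have htt : t * t = t := hinj' _ _ (by rw [hmap, ← hpt]; exact hp)
  -- the left ideal generated by the minimal idempotent is minimal, contradicting `hsoc`
  let L : Submodule ℂ D :=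
    { carrier := {s | s * t = s}
      add_mem' := fun {a b} ha hb => by
        simp only [mem_ofPred_eq, add_mul] at *
        rw [ha, hb]
      zero_mem' := by simp
      smul_mem' := fun c a ha => by
        simp only [mem_ofPred_eq, smul_mul_assoc] at *
        rw [ha] }
  have hLl : IsLeftIdeal L := fun a x hx => by
    change a * x * t = a * x
    rw [mul_assoc, show x * t = x from hx]
  have htL : t ∈ L := htt
  have ht0 : t ≠ 0 := fun h => hp0 (by rw [hpt, h, Unitization.inr_zero, map_zero])
  refine ht0 (hsoc t (AlgIdeal.mem_socle_iff.2 ((le_sSup (a := L) ?_ : L ≤ _) htL)))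
  refine ⟨⟨hLl, fun h => ht0 ?_⟩, ?_⟩
  · rwa [h, Submodule.mem_bot] at htL
  · rintro K ⟨hK, hK0⟩ hKL
    obtain ⟨k, hk, hk0⟩ := Submodule.exists_mem_ne_zero_of_ne_bot hK0
    have hkt : e (k : Unitization ℂ D) * p = e (k : Unitization ℂ D) := by
      rw [hpt, ← hmap, show k * t = k from hKL hk]
    -- semisimplicity provides `y` with `p y k ≠ 0`, a scalar multiple of `p` in `K`
    obtain ⟨y, hy⟩ : ∃ y, p * y * e (k : Unitization ℂ D) ≠ 0 := by
      by_contra! h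
      refine hk0 (hinj k (hss _ fun y => ?_))
      have hsq : e (k : Unitization ℂ D) * y * (e (k : Unitization ℂ D) * y) = 0 := by
        rw [← mul_assoc]
        nth_rw 1 [← hkt]
        rw [mul_assoc (e (k : Unitization ℂ D)), mul_assoc (e (k : Unitization ℂ D)), h, mul_zero,
          zero_mul]
      refine isUnit_iff_exists.2 ⟨1 + e (k : Unitization ℂ D) * y, ?_, ?_⟩
      all_goals
        simp only [sub_mul, mul_add, add_mul, mul_sub, one_mul, mul_one, hsq]
        abel
    obtain ⟨c, hc⟩ := hmin (y * e (k : Unitization ℂ D))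
    rw [mul_assoc, mul_assoc, hkt, ← mul_assoc] at hc
    have hc0 : c ≠ 0 := by
      rintro rfl
      rw [zero_smul] at hc
      exact hy hc
    obtain ⟨k', hk', hk'K⟩ := exists_inr_eq_mul (e.symm (p * y)) k
    have hk'c : k' = c • t := hinj' _ _ (by
      rw [hk', map_mul, e.apply_symm_apply, hc, hpt, Unitization.inr_smul, map_smul])
    have htK : t ∈ K := by
      have := K.smul_mem c⁻¹ (hk'K K hK hk)
      rwa [hk'c, smul_smul, inv_mul_cancel₀ hc0, one_smul] at this
    intro s hs
    rw [← show s * t = s from hs]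
    exact hK s t htK

end Socle

end ScatAlg

namespace ScatAlg

open Set Filter Topology Metric Bornology

/-! ### Spectra in algebras without identity and in quotients -/

section Quasispectrum

variable {A : Type u} [NonUnitalRing A] [Module ℂ A] [IsScalarTower ℂ A A] [SMulCommClass ℂ A A]

/-- The elements `y` are those for which `z⁻¹ (1 + y)` inverts `z - a` in the unitization. -/
theorem notMem_quasispectrum_iff {a : A} {z : ℂ} : z ∉ quasispectrum ℂ a ↔
    z ≠ 0 ∧ ∃ y, z • y = a + a * y ∧ z • y = a + y * a := by
  have key : ∀ hz : z ≠ 0, IsQuasiregular (-(z⁻¹ • a)) ↔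
      ∃ y, z • y = a + a * y ∧ z • y = a + y * a := fun hz => by
    have h : ∀ y t : A, y + -(z⁻¹ • a) + -(z⁻¹ • t) = 0 ↔ z • y = a + t := fun y t => by
      rw [← (smul_right_injective A hz).eq_iff, smul_add, smul_add, smul_neg, smul_neg,
        smul_inv_smul₀ hz, smul_inv_smul₀ hz, smul_zero, add_assoc, ← neg_add,
        ← sub_eq_add_neg, sub_eq_zero]
    rw [isQuasiregular_iff]
    refine exists_congr fun y => ?_
    rw [← h y (a * y), ← h y (y * a), neg_mul, mul_neg, smul_mul_assoc, mul_smul_comm,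
      add_comm (-(z⁻¹ • a)) y]
  rw [quasispectrum, mem_ofPred_eq]
  push Not
  constructor
  · rintro ⟨hr, h⟩
    refine ⟨hr.ne_zero, (key hr.ne_zero).1 ?_⟩
    rwa [Units.smul_def, Units.val_inv_eq_inv_val, IsUnit.unit_spec] at h
  · rintro ⟨hz, h⟩
    refine ⟨hz.isUnit, ?_⟩
    rw [Units.smul_def, Units.val_inv_eq_inv_val, IsUnit.unit_spec]
    exact (key hz).2 h

theorem exists_inverse_iff {e a : A} (he : IsIdentity e) {z : ℂ} (hz : z ≠ 0) :
    (∃ b, (z • e - a) * b = e ∧ b * (z • e - a) = e) ↔ z ∉ quasispectrum ℂ a := by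
  rw [notMem_quasispectrum_iff, and_iff_right hz]
  constructor
  · rintro ⟨b, h1, h2⟩
    rw [sub_mul, smul_mul_assoc, (he b).1, sub_eq_iff_eq_add] at h1
    rw [mul_sub, mul_smul_comm, (he b).2, sub_eq_iff_eq_add] at h2
    refine ⟨z • b - e, ?_, ?_⟩
    · rw [mul_sub, (he a).2, add_sub_cancel, mul_smul_comm, h1, add_sub_cancel_left]
    · rw [sub_mul, (he a).1, add_sub_cancel, smul_mul_assoc, h2, add_sub_cancel_left]
  · rintro ⟨y, h1, h2⟩
    refine ⟨z⁻¹ • (e + y), ?_, ?_⟩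
    · rw [mul_smul_comm, sub_mul, smul_mul_assoc, (he _).1, mul_add, (he a).2, smul_add, h1,
        add_sub_cancel_right, inv_smul_smul₀ hz]
    · rw [smul_mul_assoc, mul_sub, mul_smul_comm, (he _).2, add_mul, (he a).1, smul_add, h2,
        add_sub_cancel_right, inv_smul_smul₀ hz]

theorem algSpectrum_subset_quasispectrum (a : A) : algSpectrum a ⊆ quasispectrum ℂ a := by
  rintro z (⟨e, he, h⟩ | ⟨-, h⟩)
  · by_contra hz
    exact h ((exists_inverse_iff he (notMem_quasispectrum_iff.1 hz).1).2 hz)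
  · rwa [Unitization.quasispectrum_eq_spectrum_inr]

theorem quasispectrum_subset_insert_algSpectrum (a : A) :
    quasispectrum ℂ a ⊆ insert 0 (algSpectrum a) := by
  intro z hz
  rcases eq_or_ne z 0 with h0 | h0
  · exact Or.inl h0
  · refine Or.inr ?_
    by_cases he : ∃ e : A, IsIdentity e
    · obtain ⟨e, he⟩ := he
      exact Or.inl ⟨e, he, fun h => (exists_inverse_iff he h0).1 h hz⟩
    · exact Or.inr ⟨he, by rwa [← Unitization.quasispectrum_eq_spectrum_inr]⟩

theorem countable_algSpectrum_iff {a : A} :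
    (algSpectrum a).Countable ↔ (quasispectrum ℂ a).Countable :=
  ⟨fun h => (h.insert 0).mono (quasispectrum_subset_insert_algSpectrum a),
    fun h => h.mono (algSpectrum_subset_quasispectrum a)⟩

theorem quasispectrum_zero_subset : quasispectrum ℂ (0 : A) ⊆ {0} := by
  intro z hz
  by_contra h0
  exact notMem_quasispectrum_iff.2 ⟨h0, 0, by simp, by simp⟩ hz

theorem quasispectrum_subset_of_subalgebra (J : NonUnitalSubalgebra ℂ A) (a : J) :
    quasispectrum ℂ (a : A) ⊆ quasispectrum ℂ a := by
  intro z hz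
  by_contra h
  obtain ⟨h0, y, h1, h2⟩ := notMem_quasispectrum_iff.1 h
  exact notMem_quasispectrum_iff.2
    ⟨h0, (y : A), congrArg Subtype.val h1, congrArg Subtype.val h2⟩ hz

/-- Quasi-inverses of elements of a one-sided ideal belong to the ideal. -/
theorem quasispectrum_oneSidedSubalgebra_subset {J : Submodule ℂ A}
    (hJ : IsLeftIdeal J ∨ IsRightIdeal J) (a : oneSidedSubalgebra J hJ) :
    quasispectrum ℂ a ⊆ quasispectrum ℂ (a : A) := by
  intro z hz
  by_contra h
  obtain ⟨h0, y, h1, h2⟩ := notMem_quasispectrum_iff.1 h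
  have ha : (a : A) ∈ J := a.2
  have hy : y ∈ J := by
    rw [← inv_smul_smul₀ h0 y]
    refine J.smul_mem _ ?_
    rcases hJ with hJ | hJ
    · rw [h2]
      exact J.add_mem ha (hJ _ _ ha)
    · rw [h1]
      exact J.add_mem ha (hJ _ _ ha)
  exact notMem_quasispectrum_iff.2 ⟨h0, ⟨y, hy⟩, Subtype.ext h1, Subtype.ext h2⟩ hz

namespace AlgIdeal

theorem notMem_quasispectrum_quotMap_iff {I : AlgIdeal A} {a : A} {z : ℂ} :
    z ∉ quasispectrum ℂ (I.quotMap a) ↔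
      z ≠ 0 ∧ ∃ y, z • y - (a + a * y) ∈ I ∧ z • y - (a + y * a) ∈ I := by
  rw [notMem_quasispectrum_iff, I.quotMap_surjective.exists]
  simp only [← quotMap_eq_iff, map_smul, map_add, quotMap_mul]

theorem quasispectrum_quotMap_zero (a : A) :
    quasispectrum ℂ ((zero : AlgIdeal A).quotMap a) = quasispectrum ℂ a := by
  ext z
  rw [← not_iff_not, notMem_quasispectrum_quotMap_iff, notMem_quasispectrum_iff]
  have h : ∀ x : A, x ∈ (zero : AlgIdeal A) ↔ x = 0 := fun x => Submodule.mem_bot ℂ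
  simp only [h, sub_eq_zero]

theorem quasispectrum_quotMap_anti {I J : AlgIdeal A} (h : I ≤ J) (a : A) :
    quasispectrum ℂ (J.quotMap a) ⊆ quasispectrum ℂ (I.quotMap a) := by
  intro z hz
  by_contra hn
  obtain ⟨h0, y, h1, h2⟩ := notMem_quasispectrum_quotMap_iff.1 hn
  exact notMem_quasispectrum_quotMap_iff.2 ⟨h0, y, h h1, h h2⟩ hz

theorem quasispectrum_quotMap_subset (I : AlgIdeal A) (a : A) :
    quasispectrum ℂ (I.quotMap a) ⊆ quasispectrum ℂ a := by
  rw [← quasispectrum_quotMap_zero a]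
  refine quasispectrum_quotMap_anti (fun x hx => ?_) a
  rw [show x = 0 from hx]
  exact I.toSubmodule.zero_mem

theorem quasispectrum_quotMap_preimage (I : AlgIdeal A) (K : AlgIdeal I.Quot) (a : A) :
    quasispectrum ℂ ((I.preimage K).quotMap a) = quasispectrum ℂ (K.quotMap (I.quotMap a)) := by
  ext z
  rw [← not_iff_not, notMem_quasispectrum_quotMap_iff, notMem_quasispectrum_quotMap_iff,
    I.quotMap_surjective.exists]
  simp only [mem_preimage, map_sub, map_smul, map_add, quotMap_mul]

theorem quasispectrum_quotMap_sum {ι : Type*} [Nonempty ι] {I : ι → AlgIdeal A}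
    (hI : Directed (· ≤ ·) I) (a : A) :
    quasispectrum ℂ ((sum I).quotMap a) = ⋂ i, quasispectrum ℂ ((I i).quotMap a) := by
  have hdir : Directed (· ≤ ·) fun i => (I i).toSubmodule := hI
  have hmem : ∀ x, x ∈ sum I ↔ ∃ i, x ∈ I i := fun x => Submodule.mem_iSup_of_directed _ hdir
  ext z
  rw [← not_iff_not, mem_iInter, not_forall]
  simp only [notMem_quasispectrum_quotMap_iff, hmem]
  constructor
  · rintro ⟨h0, y, ⟨i, hi⟩, ⟨j, hj⟩⟩
    obtain ⟨k, hik, hjk⟩ := hI i j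
    exact ⟨k, h0, y, hik hi, hjk hj⟩
  · rintro ⟨i, h0, y, h1, h2⟩
    exact ⟨h0, y, ⟨i, h1⟩, ⟨i, h2⟩⟩

end AlgIdeal

theorem quasispectrum_quotMap_jacobsonRadical (a : A) :
    quasispectrum ℂ ((jacobsonRadical A).quotMap a) = quasispectrum ℂ a := by
  refine (AlgIdeal.quasispectrum_quotMap_subset _ a).antisymm fun z hz => ?_
  rw [Unitization.quasispectrum_eq_spectrum_inr, spectrum.mem_iff] at hz ⊢
  refine fun h => hz (isUnit_of_isUnit_map_quotHom_jacobsonRadical ?_)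
  rw [map_sub, AlgHom.commutes, unitizationMap_inr]
  exact h

end Quasispectrum

/-! ### The convolution chain -/

section Chain

/-- Stability of the convolution chain means that `psoc(A/R) = 0` for the scattered radical `R`. -/
theorem eq_zero_of_mem_presocle_scatteredRadical_quot {A : Type u} [NonUnitalRing A] [Module ℂ A]
    [IsScalarTower ℂ A A] [SMulCommClass ℂ A A] {b : (scatteredRadical A).Quot}
    (hb : b ∈ presocle (scatteredRadical A).Quot) : b = 0 := by
  have hst : convolutionChain A (sInf {δ | convolutionChain A (δ + 1) = convolutionChain A δ} + 1) =
      scatteredRadical A := csInf_mem (exists_stable A)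
  obtain ⟨a, rfl⟩ := (scatteredRadical A).quotMap_surjective b
  rw [AlgIdeal.quotMap_eq_zero_iff]
  have ha : a ∈ (scatteredRadical A).preimage (presocle (scatteredRadical A).Quot) := hb
  rwa [scatteredRadical, ← convolutionChain_succ, hst] at ha

variable {A : Type u} [NonUnitalNormedRing A] [NormedSpace ℂ A] [IsScalarTower ℂ A A]
  [SMulCommClass ℂ A A] [CompleteSpace A]

/-- The homomorphism of unitizations induced by `A → A/I`, on the Banach algebra `A ⊕ ℂ`. -/
noncomputable def unitizationQuot (I : AlgIdeal A) :
    WithLp 1 (Unitization ℂ A) →ₐ[ℂ] Unitization ℂ I.Quot :=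
  (unitizationMap I.quotHom).comp (WithLp.unitizationAlgEquiv (𝕜 := ℂ) (A := A) ℂ).toAlgHom

omit [CompleteSpace A] in
theorem unitizationQuot_surjective (I : AlgIdeal A) : Function.Surjective (unitizationQuot I) :=
  (unitizationMap_surjective I.quotMap_surjective).comp
    (WithLp.unitizationAlgEquiv (𝕜 := ℂ) (A := A) ℂ).surjective

theorem isClosed_quasispectrum_quotMap (I : AlgIdeal A) (a : A) :
    IsClosed (quasispectrum ℂ (I.quotMap a)) := by
  have h := isClosed_spectrum_map (unitizationQuot I) (unitizationQuot_surjective I)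
    ((WithLp.unitizationAlgEquiv (𝕜 := ℂ) (A := A) ℂ).symm a)
  have h1 : unitizationQuot I ((WithLp.unitizationAlgEquiv (𝕜 := ℂ) (A := A) ℂ).symm a) =
      (I.quotMap a : Unitization ℂ I.Quot) := by
    change unitizationMap I.quotHom (WithLp.unitizationAlgEquiv (𝕜 := ℂ) (A := A) ℂ
      ((WithLp.unitizationAlgEquiv (𝕜 := ℂ) (A := A) ℂ).symm a)) = _
    rw [AlgEquiv.apply_symm_apply, unitizationMap_inr]
    rfl
  rwa [h1, ← Unitization.quasispectrum_eq_spectrum_inr] at h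

theorem exists_quasispectrum_subset_closedBall (a : A) :
    ∃ r > 0, quasispectrum ℂ a ⊆ closedBall 0 r := by
  have h : quasispectrum ℂ a =
      spectrum ℂ ((WithLp.unitizationAlgEquiv (𝕜 := ℂ) (A := A) ℂ).symm a) := by
    rw [AlgEquiv.spectrum_eq, Unitization.quasispectrum_eq_spectrum_inr]
  obtain ⟨r, hr⟩ := (spectrum.isBounded (𝕜 := ℂ)
    ((WithLp.unitizationAlgEquiv (𝕜 := ℂ) (A := A) ℂ).symm a)).subset_closedBall 0
  refine ⟨max r 1, by positivity, ?_⟩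
  rw [h]
  exact hr.trans (closedBall_subset_closedBall (le_max_left _ _))

theorem isBounded_quasispectrum_quotMap (I : AlgIdeal A) (a : A) :
    IsBounded (quasispectrum ℂ (I.quotMap a)) := by
  obtain ⟨r, -, hr⟩ := exists_quasispectrum_subset_closedBall a
  exact isBounded_closedBall.subset ((I.quasispectrum_quotMap_subset a).trans hr)

/-- The semisimple quotient `(A/I)/rad(A/I)` has a Banach algebra norm, even if `I` is not
closed. -/
theorem exists_normedRing_unitization_quot (I : AlgIdeal A) :
    ∃ (F : Type u) (_ : NormedRing F) (_ : NormedAlgebra ℂ F) (_ : CompleteSpace F),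
      Nonempty (Unitization ℂ (jacobsonRadical I.Quot).Quot ≃ₐ[ℂ] F) :=
  exists_normedRing_of_jacobson_eq_bot
    ((unitizationMap (jacobsonRadical I.Quot).quotHom).comp (unitizationQuot I))
    ((unitizationMap_surjective (jacobsonRadical I.Quot).quotMap_surjective).comp
      (unitizationQuot_surjective I))
    (jacobson_unitization_eq_bot eq_zero_of_mem_jacobsonRadical_quot)

theorem countable_quasispectrum_inter_outerComponent_presocle (I : AlgIdeal A) (a : A) :
    (quasispectrum ℂ (I.quotMap a) ∩ outerComponent
      (quasispectrum ℂ ((I.preimage (presocle I.Quot)).quotMap a))).Countable := by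
  obtain ⟨F, _, _, _, ⟨e⟩⟩ := exists_normedRing_unitization_quot I
  rw [AlgIdeal.quasispectrum_quotMap_preimage, presocle, AlgIdeal.quasispectrum_quotMap_preimage,
    ← quasispectrum_quotMap_jacobsonRadical (I.quotMap a)]
  exact countable_quasispectrum_inter_outerComponent_socle e _

/-- Modulo each member of the chain, the spectrum loses at most countably many points of its
outer component. -/
theorem countable_quasispectrum_inter_outerComponent_convolutionChain (a : A) (α : Ordinal.{u}) :
    (quasispectrum ℂ a ∩
      outerComponent (quasispectrum ℂ ((convolutionChain A α).quotMap a))).Countable := by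
  induction α using Ordinal.limitRecOn with
  | zero =>
    rw [convolutionChain_zero, AlgIdeal.quasispectrum_quotMap_zero]
    refine countable_empty.mono fun z hz => ?_
    exact outerComponent_subset_compl _ hz.2 hz.1
  | add_one α ih =>
    have hstep := countable_quasispectrum_inter_outerComponent_presocle (convolutionChain A α) a
    rw [← convolutionChain_succ] at hstep
    have hdiff := outerComponent_diff_subset (isClosed_quasispectrum_quotMap _ a)
      (isBounded_quasispectrum_quotMap _ a) hstep
      (AlgIdeal.quasispectrum_quotMap_anti (convolutionChain_mono A le_self_add) a)
    refine (hstep.union ih).mono fun z hz => ?_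
    by_cases hzK : z ∈ quasispectrum ℂ ((convolutionChain A α).quotMap a)
    · exact Or.inl ⟨hzK, hz.2⟩
    · exact Or.inr ⟨hz.1, hdiff ⟨hz.2, hzK⟩⟩
  | limit α hα ih =>
    have : Nonempty (Iio α) := ⟨⟨0, hα.bot_lt⟩⟩
    have hdir : Directed (· ≤ ·) fun γ : Iio α => convolutionChain A γ.1 :=
      directed_of_isDirected_le fun β γ h => convolutionChain_mono A h
    obtain ⟨r, hr, hb⟩ := exists_quasispectrum_subset_closedBall a
    rw [convolutionChain_limit A hα, AlgIdeal.quasispectrum_quotMap_sum hdir]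
    have hsub := outerComponent_iInter_subset hr
      (fun γ : Iio α => isClosed_quasispectrum_quotMap (convolutionChain A γ.1) a)
      (fun γ => (AlgIdeal.quasispectrum_quotMap_subset _ a).trans hb)
      (directed_of_isDirected_le fun β γ h =>
        AlgIdeal.quasispectrum_quotMap_anti (convolutionChain_mono A h) a)
    -- countably many of the open sets already cover the union
    obtain ⟨T, hT, hTU⟩ := TopologicalSpace.isOpen_iUnion_countable
      (fun γ : Iio α => outerComponent (quasispectrum ℂ ((convolutionChain A γ.1).quotMap a)))
      (fun γ => isOpen_outerComponent (isClosed_quasispectrum_quotMap _ a))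
    refine (hT.biUnion fun γ _ => ih γ.1 γ.2).mono fun z hz => ?_
    have hz2 := hsub hz.2
    rw [← hTU] at hz2
    obtain ⟨γ, hγ, hzγ⟩ := mem_iUnion₂.1 hz2
    exact mem_iUnion₂.2 ⟨γ, hγ, hz.1, hzγ⟩

end Chain

/-! ### The scattered radical -/

section ScatteredRadical

variable {A : Type u} [NonUnitalNormedRing A] [NormedSpace ℂ A] [IsScalarTower ℂ A A]
  [SMulCommClass ℂ A A] [CompleteSpace A]

/-- Modulo the scattered radical there is neither a Jacobson radical nor a socle. -/
theorem mem_scatteredRadical_of_forall_mul {a : A}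
    (ha : ∀ x, (quasispectrum ℂ (a * x)).Countable) : a ∈ scatteredRadical A := by
  set R := scatteredRadical A
  obtain ⟨F, _, _, _, ⟨e⟩⟩ := exists_normedRing_unitization_quot R
  have hrad : (jacobsonRadical R.Quot).quotMap (R.quotMap a) = 0 := by
    refine eq_zero_of_countable_of_socle_eq_zero e eq_zero_of_mem_jacobsonRadical_quot
      (fun d hd => ?_) fun x => ?_
    · obtain ⟨b, rfl⟩ := (jacobsonRadical R.Quot).quotMap_surjective d
      rw [eq_zero_of_mem_presocle_scatteredRadical_quot (show b ∈ presocle R.Quot from hd),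
        map_zero]
    · obtain ⟨x, rfl⟩ := (jacobsonRadical R.Quot).quotMap_surjective x
      obtain ⟨x, rfl⟩ := R.quotMap_surjective x
      rw [← AlgIdeal.quotMap_mul, ← AlgIdeal.quotMap_mul]
      exact (ha x).mono ((AlgIdeal.quasispectrum_quotMap_subset _ _).trans
        (AlgIdeal.quasispectrum_quotMap_subset _ _))
  rw [AlgIdeal.quotMap_eq_zero_iff] at hrad
  rw [← AlgIdeal.quotMap_eq_zero_iff]
  exact eq_zero_of_mem_presocle_scatteredRadical_quot (AlgIdeal.le_preimage _ _ hrad)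

/-- Countability of the spectrum lifts modulo the scattered radical. -/
theorem countable_quasispectrum_of_countable_quot {a : A}
    (ha : (quasispectrum ℂ ((scatteredRadical A).quotMap a)).Countable) :
    (quasispectrum ℂ a).Countable := by
  have h := countable_quasispectrum_inter_outerComponent_convolutionChain a
    (sInf {δ | convolutionChain A (δ + 1) = convolutionChain A δ})
  rw [← scatteredRadical,
    outerComponent_of_countable ha (isBounded_quasispectrum_quotMap _ a)] at h
  refine (h.union ha).mono fun z hz => ?_
  by_cases hzK : z ∈ quasispectrum ℂ ((scatteredRadical A).quotMap a)
  · exact Or.inr hzK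
  · exact Or.inl ⟨hz, hzK⟩

theorem countable_quasispectrum_of_mem_scatteredRadical {a : A} (ha : a ∈ scatteredRadical A) :
    (quasispectrum ℂ a).Countable := by
  refine countable_quasispectrum_of_countable_quot ?_
  rw [(AlgIdeal.quotMap_eq_zero_iff _).2 ha]
  exact (countable_singleton 0).mono quasispectrum_zero_subset

theorem le_scatteredRadical_of_subset {I : AlgIdeal A}
    (hI : (I : Set A) ⊆ countableSpectrumSet A) : I ≤ scatteredRadical A := fun a ha =>
  mem_scatteredRadical_of_forall_mul fun x =>
    countable_algSpectrum_iff.1 (hI (I.mul_right_mem x a ha))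

theorem scatteredRadical_subset_countableSpectrumSet :
    (scatteredRadical A : Set A) ⊆ countableSpectrumSet A := fun _ ha =>
  countable_algSpectrum_iff.2 (countable_quasispectrum_of_mem_scatteredRadical ha)

theorem isThin_scatteredRadical : IsThin (scatteredRadical A) := by
  intro a
  set K := quasispectrum ℂ ((scatteredRadical A).quotMap a)
  set C := closure (algSpectrum ((scatteredRadical A).quotMap a)) with hC
  have hKcl : IsClosed K := isClosed_quasispectrum_quotMap _ a
  have hKb : IsBounded K := isBounded_quasispectrum_quotMap _ a
  have hCK : C ⊆ K := closure_minimal (algSpectrum_subset_quasispectrum _) hKcl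
  -- `C` and `K` differ at most by the point `0`
  have hKC : K ∩ outerComponent C ⊆ {0} := fun z hz => by
    rcases quasispectrum_subset_insert_algSpectrum _ hz.1 with h0 | h
    · exact h0
    · exact absurd (subset_closure h) (outerComponent_subset_compl _ hz.2)
  have hdiff := outerComponent_diff_subset isClosed_closure hKb
    ((countable_singleton 0).mono hKC) hCK
  refine ⟨(quasispectrum ℂ a ∩ outerComponent K) ∪ {0},
    (countable_quasispectrum_inter_outerComponent_convolutionChain a _).union
      (countable_singleton 0), fun z hz => ?_⟩
  by_cases hzC : z ∈ outerComponent C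
  · right
    by_cases hzK : z ∈ K
    · exact Or.inr (hKC ⟨hzK, hzC⟩)
    · exact Or.inl ⟨algSpectrum_subset_quasispectrum a hz, hdiff ⟨hzC, hzK⟩⟩
  · left
    exact polyHull_closure_subset _
      (compl_outerComponent_subset_polyHull isClosed_closure (hKb.subset hCK) hzC)

omit [CompleteSpace A] in
theorem IsThin.subset_countableSpectrumSet {I : AlgIdeal A} (hI : IsThin I) :
    (I : Set A) ⊆ countableSpectrumSet A := by
  intro a ha
  obtain ⟨Z, hZ, h⟩ := hI a
  rw [(I.quotMap_eq_zero_iff).2 ha] at h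
  refine ((countable_singleton 0).union hZ).mono (h.trans (union_subset_union_left _ ?_))
  exact (polyHull_mono ((algSpectrum_subset_quasispectrum _).trans
    quasispectrum_zero_subset)).trans (polyHull_singleton_subset 0)

theorem IsScatteredIdeal.le_scatteredRadical {J : Submodule ℂ A} (hJ : IsScatteredIdeal J) :
    J ≤ (scatteredRadical A).toSubmodule := by
  obtain ⟨h, hs⟩ := hJ
  have hcount : ∀ a ∈ J, (quasispectrum ℂ a).Countable := fun a ha =>
    (countable_algSpectrum_iff.1 (hs ⟨a, ha⟩)).mono
      (quasispectrum_subset_of_subalgebra (oneSidedSubalgebra J h) ⟨a, ha⟩)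
  refine fun a ha => mem_scatteredRadical_of_forall_mul fun x => ?_
  rcases h with h | h
  · rw [quasispectrum.mul_comm]
    exact hcount _ (h x a ha)
  · exact hcount _ (h x a ha)

theorem isScatteredIdeal_scatteredRadical :
    IsScatteredIdeal (scatteredRadical A).toSubmodule :=
  ⟨Or.inl (scatteredRadical A).mul_left_mem, fun a => countable_algSpectrum_iff.2
    ((countable_quasispectrum_of_mem_scatteredRadical a.2).mono
      (quasispectrum_oneSidedSubalgebra_subset _ a))⟩

end ScatteredRadical

end ScatAlg

theorem mainTheorem6 (A : Type u) [NonUnitalNormedRing A] [NormedSpace ℂ A]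
    [IsScalarTower ℂ A A] [SMulCommClass ℂ A A] [CompleteSpace A] :
    (∀ J : Submodule ℂ A, ScatAlg.IsScatteredIdeal J →
      J ≤ (ScatAlg.scatteredRadical A).toSubmodule) ∧
    IsGreatest {I : ScatAlg.AlgIdeal A | ScatAlg.IsThin I} (ScatAlg.scatteredRadical A) ∧
    IsGreatest {I : ScatAlg.AlgIdeal A | ScatAlg.IsScatteredIdeal I.toSubmodule}
      (ScatAlg.scatteredRadical A) ∧
    (ScatAlg.scatteredRadical A : Set A) =
      {a | ∀ x : A, (ScatAlg.algSpectrum (a * x)).Countable} ∧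
    IsGreatest {I : ScatAlg.AlgIdeal A | (I : Set A) ⊆ ScatAlg.countableSpectrumSet A}
      (ScatAlg.scatteredRadical A) ∧
    (ScatAlg.scatteredRadical A : Set A) + ScatAlg.countableSpectrumSet A ⊆
      ScatAlg.countableSpectrumSet A := by
  refine ⟨fun J hJ => hJ.le_scatteredRadical,
    ⟨ScatAlg.isThin_scatteredRadical,
      fun I hI => ScatAlg.le_scatteredRadical_of_subset hI.subset_countableSpectrumSet⟩,
    ⟨ScatAlg.isScatteredIdeal_scatteredRadical, fun I hI => hI.le_scatteredRadical⟩, ?_,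
    ⟨ScatAlg.scatteredRadical_subset_countableSpectrumSet,
      fun I hI => ScatAlg.le_scatteredRadical_of_subset hI⟩, ?_⟩
  · refine Set.Subset.antisymm (fun a ha x => ?_) fun a ha => ?_
    · exact ScatAlg.scatteredRadical_subset_countableSpectrumSet
        ((ScatAlg.scatteredRadical A).mul_right_mem x a ha)
    · exact ScatAlg.mem_scatteredRadical_of_forall_mul fun x =>
        ScatAlg.countable_algSpectrum_iff.1 (ha x)
  · rintro _ ⟨r, hr, s, hs, rfl⟩
    refine ScatAlg.countable_algSpectrum_iff.2
      (ScatAlg.countable_quasispectrum_of_countable_quot ?_)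
    -- the sum `r + s` has the same image as `s` modulo the scattered radical
    change (quasispectrum ℂ ((ScatAlg.scatteredRadical A).quotMap (r + s))).Countable
    rw [map_add, (ScatAlg.AlgIdeal.quotMap_eq_zero_iff _).2 hr, zero_add]
    exact (ScatAlg.countable_algSpectrum_iff.1 hs).mono
      (ScatAlg.AlgIdeal.quasispectrum_quotMap_subset _ s)
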